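/- Let $H$ be a complex Hilbert space, and let $B(H)^+$ be the set of all bounded positive semidefinite linear operators on $H$. For $A,B\in B(H)^+$ let $A\,!\,B\in B(H)^+$ denote the harmonic mean, that is, the strong operator limit $$A\,!\,B=\lim_{\varepsilon\downarrow 0} 2\left((A+\varepsilon I)^{-1}+(B+\varepsilon I)^{-1}\right)^{-1},$$ which equals $2(A^{-1}+B^{-1})^{-1}$ if $A,B$ are invertible. Let $p\in[-1,1]$ be a nonzero real number. The conventional $p$th power mean $\mathsf m_p$ on $B(H)^+$ is defined by $$A\,\mathsf m_p\,B=\left(\frac{A^p+B^p}{2}\right)^{1/p}\ \text{ if } p>0,\qquad A\,\mathsf m_p\,B=\left(A^{|p|}\,!\,B^{|p|}\right)^{1/|p|}\ \text{ if } p<0 .$$ Let $\phi:B(H)^+\to B(H)^+$ be a bijective map such that $$\phi(A\,\mathsf m_p\,B)=\phi(A)\,\mathsf m_p\,\phi(B)\qquad (A,B\in B(H)^+).\tag{1}$$ Then there is an invertible bounded linear or conjugate-linear operator $T:H\to H$ such that $$\phi(A)=\left(TA^{|p|}T^*\right)^{1/|p|}\qquad (A\in B(H)^+),\tag{2}$$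 where the adjoint $T^*$ of a bounded conjugate-linear operator $T$ is the bounded conjugate-linear operator determined by $\langle T^*y,x\rangle=\langle Tx,y\rangle$ for all $x,y\in H$. Conversely, every map $\phi:B(H)^+\to B(H)^+$ of the form (2), with $T$ an invertible bounded linear or conjugate-linear operator on $H$, satisfies (1). -/

import Mathlib

open Filter Topology

namespace PowerMeans

variable {H : Type*} [NormedAddCommGroup H] [InnerProductSpace ℂ H] [CompleteSpace H]

/-- The cone `B(H)⁺` of bounded positive semidefinite operators on `H` (with respect to the
Loewner order). -/
abbrev PosCone (H : Type*) [NormedAddCommGroup H] [InnerProductSpace ℂ H] [CompleteSpace H] :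
    Type _ :=
  {A : H →L[ℂ] H // 0 ≤ A}

/-- The harmonic mean `2 (A⁻¹ + B⁻¹)⁻¹` of two positive invertible operators. -/
noncomputable def invHarmonicMean (A B : H →L[ℂ] H) : H →L[ℂ] H :=
  (2 : ℝ) • Ring.inverse (Ring.inverse A + Ring.inverse B)

/-- The positive operator `A + ε I`; it is invertible for `ε > 0`. -/
noncomputable def shift (A : H →L[ℂ] H) (ε : ℝ) : H →L[ℂ] H :=
  A + algebraMap ℝ (H →L[ℂ] H) ε

theorem shift_strictlyPositive {A : H →L[ℂ] H} (hA : 0 ≤ A) {ε : ℝ} (hε : 0 < ε) :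
    IsStrictlyPositive (shift A ε) := by
  have h1 : IsStrictlyPositive (algebraMap ℝ (H →L[ℂ] H) ε) :=
    ⟨by simpa using algebraMap_mono (H →L[ℂ] H) hε.le,
      (isUnit_iff_ne_zero.mpr hε.ne').map (algebraMap ℝ (H →L[ℂ] H))⟩
  exact h1.nonneg_add hA

theorem inverse_strictlyPositive {A : H →L[ℂ] H} (hA : IsStrictlyPositive A) :
    IsStrictlyPositive (Ring.inverse A) := by
  obtain ⟨u, rfl⟩ := hA.isUnit
  rw [Ring.inverse_unit]
  exact ⟨CFC.inv_nonneg_of_nonneg u hA.nonneg, u⁻¹.isUnit⟩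

theorem inverse_anti {A B : H →L[ℂ] H} (hA : IsStrictlyPositive A) (hB : IsStrictlyPositive B)
    (h : A ≤ B) : Ring.inverse B ≤ Ring.inverse A := by
  obtain ⟨u, rfl⟩ := hA.isUnit
  obtain ⟨v, rfl⟩ := hB.isUnit
  rw [Ring.inverse_unit, Ring.inverse_unit]
  exact CStarAlgebra.inv_le_inv hA.nonneg h

theorem invHarmonicMean_nonneg {A B : H →L[ℂ] H} (hA : IsStrictlyPositive A)
    (hB : IsStrictlyPositive B) : 0 ≤ invHarmonicMean A B := by
  have h := inverse_strictlyPositive ((inverse_strictlyPositive hA).add_nonneg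
    (inverse_strictlyPositive hB).nonneg)
  exact smul_nonneg (by norm_num) h.nonneg

theorem invHarmonicMean_mono {A B C D : H →L[ℂ] H} (hA : IsStrictlyPositive A)
    (hB : IsStrictlyPositive B) (hC : IsStrictlyPositive C) (hD : IsStrictlyPositive D)
    (hAC : A ≤ C) (hBD : B ≤ D) : invHarmonicMean A B ≤ invHarmonicMean C D := by
  refine smul_le_smul_of_nonneg_left ?_ (by norm_num)
  refine inverse_anti ?_ ?_ (add_le_add (inverse_anti hA hC hAC) (inverse_anti hB hD hBD))
  · exact (inverse_strictlyPositive hC).add_nonneg (inverse_strictlyPositive hD).nonneg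
  · exact (inverse_strictlyPositive hA).add_nonneg (inverse_strictlyPositive hB).nonneg

theorem norm_apply_sq_le {T : H →L[ℂ] H} (hT : 0 ≤ T) (x : H) :
    ‖T x‖ ^ 2 ≤ ‖T‖ * (inner ℂ (T x) x).re := by
  set S := CFC.sqrt T with hS
  have hS0 : 0 ≤ S := CFC.sqrt_nonneg T
  have hSS : S * S = T := CFC.sqrt_mul_sqrt_self T hT
  have hsa : IsSelfAdjoint S := hS0.isSelfAdjoint
  have hn : ‖T‖ = ‖S‖ ^ 2 := by
    rw [← hSS, sq]; exact hsa.norm_mul_self.trans (sq _)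
  have hx : (inner ℂ (T x) x).re = ‖S x‖ ^ 2 := by
    have h1 : inner ℂ (T x) x = inner ℂ (S x) (S x) := by
      rw [← hSS]
      exact hsa.isSymmetric (S x) x
    rw [h1, inner_self_eq_norm_sq_to_K]
    norm_cast
  have h2 : ‖T x‖ ≤ ‖S‖ * ‖S x‖ := by
    rw [← hSS]; exact S.le_opNorm (S x)
  rw [hn, hx, ← mul_pow]
  exact pow_le_pow_left₀ (norm_nonneg _) h2 2

open scoped ComplexOrder in
/-- An increasing family of positive operators indexed by `ε > 0` converges strongly to a positive
operator as `ε` decreases to `0`. -/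
theorem exists_strong_limit (F : ℝ → H →L[ℂ] H) (h0 : ∀ ε, 0 < ε → 0 ≤ F ε)
    (hmono : ∀ ε δ, 0 < ε → ε ≤ δ → F ε ≤ F δ) :
    ∃ C : PosCone H, ∀ x : H, Tendsto (fun ε : ℝ => F ε x) (𝓝[>] 0) (𝓝 (C.1 x)) := by
  have hq0 : ∀ (T : H →L[ℂ] H) (x : H), 0 ≤ T → 0 ≤ (inner ℂ (T x) x).re := fun T x hT =>
    ((ContinuousLinearMap.nonneg_iff_isPositive T).mp hT).re_inner_nonneg_left x
  have hsub : ∀ (x : H) (ε δ : ℝ), (inner ℂ ((F δ - F ε) x) x).re =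
      (inner ℂ (F δ x) x).re - (inner ℂ (F ε x) x).re := fun x ε δ => by
    rw [sub_apply, inner_sub_left, Complex.sub_re]
  have hcauchy : ∀ x : H, ∃ y : H, Tendsto (fun ε : ℝ => F ε x) (𝓝[>] 0) (𝓝 y) := by
    intro x
    set q : ℝ → ℝ := fun ε => (inner ℂ (F ε x) x).re with hq
    have hqmono : ∀ ε δ, 0 < ε → ε ≤ δ → q ε ≤ q δ := fun ε δ h1 h2 => by
      have h3 := hq0 (F δ - F ε) x (sub_nonneg.mpr (hmono ε δ h1 h2))
      rw [hsub] at h3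
      exact sub_nonneg.mp h3
    set L : ℝ := sInf (q '' Set.Ioi 0) with hL
    have hbdd : BddBelow (q '' Set.Ioi 0) :=
      ⟨0, by rintro _ ⟨ε, hε, rfl⟩; exact hq0 _ x (h0 ε hε)⟩
    have hLle : ∀ ε, 0 < ε → L ≤ q ε := fun ε hε => csInf_le hbdd ⟨ε, hε, rfl⟩
    have hne : (q '' Set.Ioi 0).Nonempty := ⟨q 1, 1, by simp, rfl⟩
    apply cauchy_map_iff_exists_tendsto.mp
    rw [Metric.cauchy_iff]
    refine ⟨inferInstance, fun r hr => ?_⟩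
    set M : ℝ := ‖F 1‖ + 1 with hM
    have hMpos : 0 < M := by positivity
    obtain ⟨_, ⟨d, hd, rfl⟩, hdL⟩ := exists_lt_of_csInf_lt hne
      (show L < L + r ^ 2 / M by have : 0 < r ^ 2 / M := by positivity
                                 linarith)
    have hd' : 0 < min d 1 := lt_min hd one_pos
    have key : ∀ ε δ, 0 < ε → ε ≤ δ → δ ≤ min d 1 → dist (F δ x) (F ε x) < r := by
      intro ε δ h1 h2 h3
      have hδ : 0 < δ := h1.trans_le h2
      have hnn : 0 ≤ F δ - F ε := sub_nonneg.mpr (hmono ε δ h1 h2)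
      have hle : F δ - F ε ≤ F 1 :=
        (sub_le_self _ (h0 ε h1)).trans (hmono δ 1 hδ (h3.trans (min_le_right _ _)))
      have hnorm : ‖F δ - F ε‖ ≤ M :=
        (CStarAlgebra.norm_le_norm_of_nonneg_of_le hnn hle).trans (by simp [hM])
      have h4 := norm_apply_sq_le hnn x
      rw [hsub] at h4
      have h5 : q δ - q ε < r ^ 2 / M := by
        have := hqmono δ d hδ (h3.trans (min_le_left _ _))
        have := hLle ε h1
        linarith
      have h6 : 0 ≤ q δ - q ε := sub_nonneg.mpr (hqmono ε δ h1 h2)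
      have h7 : ‖(F δ - F ε) x‖ ^ 2 < r ^ 2 :=
        calc ‖(F δ - F ε) x‖ ^ 2 ≤ ‖F δ - F ε‖ * (q δ - q ε) := h4
          _ ≤ M * (q δ - q ε) := mul_le_mul_of_nonneg_right hnorm h6
          _ < M * (r ^ 2 / M) := mul_lt_mul_of_pos_left h5 hMpos
          _ = r ^ 2 := by field_simp
      rw [dist_eq_norm, ← sub_apply]
      exact lt_of_pow_lt_pow_left₀ 2 hr.le h7
    refine ⟨(fun ε => F ε x) '' Set.Ioc 0 (min d 1), image_mem_map (Ioc_mem_nhdsGT hd'), ?_⟩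
    rintro _ ⟨ε, hε, rfl⟩ _ ⟨δ, hδ, rfl⟩
    rcases le_total ε δ with h | h
    · rw [dist_comm]; exact key ε δ hε.1 h hδ.2
    · exact key δ ε hδ.1 h hε.2
  choose f hf using hcauchy
  have hf' : Tendsto (fun (ε : ℝ) (x : H) => F ε x) (𝓝[>] 0) (𝓝 f) := tendsto_pi_nhds.mpr hf
  refine ⟨⟨continuousLinearMapOfTendsto F hf', ?_⟩, hf⟩
  rw [ContinuousLinearMap.nonneg_iff_isPositive, ContinuousLinearMap.isPositive_iff_complex]
  intro x
  have hlim : Tendsto (fun ε : ℝ => inner ℂ (F ε x) x) (𝓝[>] 0) (𝓝 (inner ℂ (f x) x)) :=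
    (hf x).inner tendsto_const_nhds
  have hnn : 0 ≤ inner ℂ (f x) x := by
    refine ge_of_tendsto hlim ?_
    filter_upwards [self_mem_nhdsWithin] with ε hε
    exact ((ContinuousLinearMap.nonneg_iff_isPositive _).mp (h0 ε hε)).inner_nonneg_left x
  have h8 := Complex.nonneg_iff.mp hnn
  exact ⟨Complex.ext rfl h8.2, h8.1⟩

/-- `(A + ε I) ! (B + ε I)` converges strongly to a positive operator as `ε` decreases to `0`. -/
theorem exists_harmonicMean (A B : PosCone H) :
    ∃ C : PosCone H, ∀ x : H, Tendsto
      (fun ε : ℝ => invHarmonicMean (shift A.1 ε) (shift B.1 ε) x) (𝓝[>] 0) (𝓝 (C.1 x)) := by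
  refine exists_strong_limit _ (fun ε hε => ?_) (fun ε δ hε hεδ => ?_)
  · exact invHarmonicMean_nonneg (shift_strictlyPositive A.2 hε) (shift_strictlyPositive B.2 hε)
  · have hδ : 0 < δ := hε.trans_le hεδ
    have h := algebraMap_mono (H →L[ℂ] H) hεδ
    exact invHarmonicMean_mono (shift_strictlyPositive A.2 hε) (shift_strictlyPositive B.2 hε)
      (shift_strictlyPositive A.2 hδ) (shift_strictlyPositive B.2 hδ)
      (add_le_add le_rfl h) (add_le_add le_rfl h)

/-- The harmonic mean of arbitrary `A, B ∈ B(H)⁺`: the strong limit of the harmonic means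
`2 ((A + ε I)⁻¹ + (B + ε I)⁻¹)⁻¹` as `ε` decreases to `0`. -/
noncomputable def harmonicMean (A B : PosCone H) : PosCone H :=
  (exists_harmonicMean A B).choose

/-- The power `A ^ r` of `A ∈ B(H)⁺`, by continuous functional calculus. -/
noncomputable def power (A : PosCone H) (r : ℝ) : PosCone H :=
  ⟨A.1 ^ r, CFC.rpow_nonneg⟩

/-- The arithmetic mean `(A + B) / 2`. -/
noncomputable def arithmeticMean (A B : PosCone H) : PosCone H :=
  ⟨(2⁻¹ : ℝ) • (A.1 + B.1), smul_nonneg (by norm_num) (add_nonneg A.2 B.2)⟩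

/-- The conventional `p`th power mean on `B(H)⁺`: it is `((A ^ p + B ^ p) / 2) ^ (1 / p)` if
`p > 0` and `(A ^ |p| ! B ^ |p|) ^ (1 / |p|)`, with the harmonic mean `!`, if `p < 0`. -/
noncomputable def powerMean (p : ℝ) (A B : PosCone H) : PosCone H :=
  if 0 < p then power (arithmeticMean (power A p) (power B p)) (1 / p)
  else power (harmonicMean (power A |p|) (power B |p|)) (1 / |p|)

/-- The adjoint of a bounded conjugate-linear operator `T`: the bounded conjugate-linear operator
with `⟪T* y, x⟫ = ⟪T x, y⟫`. -/
noncomputable def conjAdjoint (T : H →L⋆[ℂ] H) : H →L⋆[ℂ] H :=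
  ((InnerProductSpace.toDual ℂ H).symm.toContinuousLinearEquiv :
      StrongDual ℂ H →L⋆[ℂ] H).comp
    (((ContinuousLinearMap.compSL H H ℂ (starRingEnd ℂ) (starRingEnd ℂ)).flip T).comp
      (innerSLFlip ℂ : H →L[ℂ] H →L⋆[ℂ] ℂ))

theorem conjAdjoint_inner (T : H →L⋆[ℂ] H) (x y : H) :
    inner ℂ (conjAdjoint T y) x = inner ℂ (T x) y :=
  InnerProductSpace.toDual_symm_apply

/-- `φ(A) = (T A^r T*)^(1/r)` for all `A ∈ B(H)⁺`, with `T` bounded linear. -/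
def HasLinearForm (r : ℝ) (φ : PosCone H → PosCone H) (T : H →L[ℂ] H) : Prop :=
  ∀ A : PosCone H,
    (φ A).1 = (T.comp ((power A r).1.comp (ContinuousLinearMap.adjoint T))) ^ (1 / r)

/-- `φ(A) = (T A^r T*)^(1/r)` for all `A ∈ B(H)⁺`, with `T` bounded conjugate-linear. -/
def HasConjLinearForm (r : ℝ) (φ : PosCone H → PosCone H) (T : H →L⋆[ℂ] H) : Prop :=
  ∀ A : PosCone H,
    (φ A).1 = (T.comp ((power A r).1.comp (conjAdjoint T)) : H →L[ℂ] H) ^ (1 / r)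

end PowerMeans

/-!
For `p > 0` (respectively `p < 0`) the map `ψ A = φ (A ^ (1/|p|)) ^ |p|` is a bijection of the cone
preserving the arithmetic (respectively harmonic) mean, and the claim is that `ψ` is a congruence
`A ↦ T A T*`. The converse is immediate from this reformulation: congruences are linear, and the
harmonic mean is given by the variational formula
`⟪(A ! B) z, z⟫ = 2 inf_y (⟪A (z - y), z - y⟫ + ⟪B y, y⟫)`, which is invariant under a substitution
`z ↦ T* z`.

*Additive bijections* (`isCongruence_of_additive`). A bijection preserving the arithmetic mean is
additive, hence a homogeneous order automorphism, and so it permutes the extreme rays, which are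
spanned by the rank-one operators `x ⊗ x`. Extend it to a complex-linear map `G` on all operators
and fix `e ≠ 0`, with `e ⊗ e ↦ u ⊗ u`. As `(e + t y) ⊗ (e + t y)` is sent to an operator of rank one
for every complex `t`, comparing coefficients in `t` (`exists_of_pencil`) shows that `G (y ⊗ e)` is
`w ⊗ u` or `u ⊗ w` for some `w` with `y ⊗ y ↦ w ⊗ w`. The two alternatives define two subspaces
with union `H`, so one of them holds for all `y`, and `T y = w` is linear in the first case and
conjugate-linear in the second. The automorphism agrees with `A ↦ T A T*` on rank-one operators,
and a positive operator is determined by the operators `x ⊗ x` below it (`le_iff_dyad`).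

*The harmonic mean* (`isCongruence_of_harmonicMean`). The rank-one operators are characterized by
their annihilators `{B | A ! B = 0}`, so `ψ` preserves them. On a single ray `ψ` acts by a bijection
`f` of `[0, ∞)` preserving the scalar harmonic mean, whence `f` is linear. Since `R ≤ B` if and only
if `R ≤ R ! B` for `R` of rank one (`dyad_le_iff_harmonicMean`), `ψ` is a homogeneous order
automorphism; in particular it preserves invertibility. Then `A ↦ ψ (A⁻¹)⁻¹` is additive on
invertible operators and extends to an additive bijection of the cone, which is a congruence by the
first part. Thus `ψ` is a congruence on invertible operators, and everywhere by monotonicity.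
-/

set_option linter.unusedSectionVars false

namespace PowerMeans

open scoped NNReal ComplexConjugate
open InnerProductSpace (rankOne)
open ContinuousLinearMap (adjoint)

variable {H : Type*} [NormedAddCommGroup H] [InnerProductSpace ℂ H] [CompleteSpace H]

/-! ### Quadratic forms, dyads and the Loewner order -/

/-- The quadratic form `z ↦ Re ⟪A z, z⟫` of an operator. -/
noncomputable def quad (A : H →L[ℂ] H) (z : H) : ℝ := (inner ℂ (A z) z).re

theorem quad_add (A B : H →L[ℂ] H) (z : H) : quad (A + B) z = quad A z + quad B z := by
  simp [quad]

theorem quad_sub (A B : H →L[ℂ] H) (z : H) : quad (A - B) z = quad A z - quad B z := by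
  simp [quad]

theorem quad_smul (c : ℝ) (A : H →L[ℂ] H) (z : H) : quad (c • A) z = c * quad A z := by
  simp [quad]

theorem quad_one (z : H) : quad (1 : H →L[ℂ] H) z = ‖z‖ ^ 2 := by
  simp [quad, inner_self_eq_norm_sq_to_K]
  norm_cast

theorem quad_nonneg {A : H →L[ℂ] H} (hA : 0 ≤ A) (z : H) : 0 ≤ quad A z :=
  ((ContinuousLinearMap.nonneg_iff_isPositive A).mp hA).re_inner_nonneg_left z

theorem le_iff_quad {A B : H →L[ℂ] H} (hA : 0 ≤ A) (hB : 0 ≤ B) :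
    A ≤ B ↔ ∀ z, quad A z ≤ quad B z := by
  rw [← sub_nonneg, ContinuousLinearMap.nonneg_iff_isPositive, ContinuousLinearMap.isPositive_def']
  refine ⟨fun h z => ?_, fun h => ⟨hB.isSelfAdjoint.sub hA.isSelfAdjoint, fun z => ?_⟩⟩
  · have := h.2 z
    change 0 ≤ quad (B - A) z at this
    rw [quad_sub] at this
    linarith
  · change 0 ≤ quad (B - A) z
    rw [quad_sub]
    linarith [h z]

theorem PosCone.le_iff {A B : PosCone H} : A ≤ B ↔ ∀ z, quad A.1 z ≤ quad B.1 z :=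
  le_iff_quad A.2 B.2

theorem PosCone.ext_quad {A B : PosCone H} (h : ∀ z, quad A.1 z = quad B.1 z) : A = B :=
  le_antisymm (PosCone.le_iff.mpr fun z => (h z).le) (PosCone.le_iff.mpr fun z => (h z).ge)

theorem quad_eq_inner {A : H →L[ℂ] H} (hA : 0 ≤ A) (z : H) :
    inner ℂ (A z) z = (quad A z : ℂ) := by
  have h := ((ContinuousLinearMap.nonneg_iff_isPositive A).mp hA).inner_nonneg_left z
  exact Complex.ext rfl (by simpa using (Complex.nonneg_iff.mp h).2.symm)

theorem inner_apply_comm {A : H →L[ℂ] H} (hA : 0 ≤ A) (x y : H) :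
    inner ℂ (A x) y = inner ℂ x (A y) :=
  ((ContinuousLinearMap.nonneg_iff_isPositive A).mp hA).inner_left_eq_inner_right x y

/-- The Cauchy–Schwarz inequality for the form `⟪A x, y⟫`. -/
theorem norm_inner_sq_le {A : H →L[ℂ] H} (hA : 0 ≤ A) (x y : H) :
    ‖inner ℂ (A x) y‖ ^ 2 ≤ quad A x * quad A y := by
  set S := CFC.sqrt A with hS
  have hS0 : 0 ≤ S := CFC.sqrt_nonneg A
  have hSS : S * S = A := CFC.sqrt_mul_sqrt_self A hA
  have h1 : ∀ a b, inner ℂ (A a) b = inner ℂ (S a) (S b) := fun a b => by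
    rw [← hSS]; exact inner_apply_comm hS0 (S a) b
  have hq : ∀ a, quad A a = ‖S a‖ ^ 2 := fun a => by
    rw [quad, h1, inner_self_eq_norm_sq_to_K]; norm_cast
  rw [hq, hq, h1, ← mul_pow]
  exact pow_le_pow_left₀ (norm_nonneg _) (norm_inner_le_norm _ _) 2

theorem apply_eq_zero_of_quad {A : H →L[ℂ] H} (hA : 0 ≤ A) {z : H} (h : quad A z = 0) :
    A z = 0 := by
  have h1 := norm_apply_sq_le hA z
  change _ ≤ ‖A‖ * quad A z at h1
  rw [h, mul_zero] at h1
  exact norm_eq_zero.mp (pow_eq_zero_iff two_ne_zero |>.mp (le_antisymm h1 (sq_nonneg _)))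

theorem quad_smul_vec (A : H →L[ℂ] H) (c : ℂ) (z : H) : quad A (c • z) = ‖c‖ ^ 2 * quad A z := by
  have : inner ℂ (A (c • z)) (c • z) = ((‖c‖ ^ 2 : ℝ) : ℂ) * inner ℂ (A z) z := by
    rw [map_smul, inner_smul_left, inner_smul_right, ← mul_assoc, Complex.conj_mul']
    push_cast; ring
  rw [quad, this, Complex.re_ofReal_mul, quad]

theorem quad_le_norm (A : H →L[ℂ] H) (z : H) : quad A z ≤ ‖A‖ * ‖z‖ ^ 2 := by
  calc quad A z ≤ ‖inner ℂ (A z) z‖ := Complex.re_le_norm _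
    _ ≤ ‖A z‖ * ‖z‖ := norm_inner_le_norm _ _
    _ ≤ ‖A‖ * ‖z‖ * ‖z‖ := by gcongr; exact A.le_opNorm z
    _ = _ := by ring

/-- The positive operator `x ⊗ x : z ↦ ⟪x, z⟫ x`, of rank one if `x ≠ 0`. -/
noncomputable def dyad (x : H) : PosCone H :=
  ⟨InnerProductSpace.rankOne ℂ x x, (ContinuousLinearMap.nonneg_iff_isPositive _).mpr
    (InnerProductSpace.isPositive_rankOne_self x)⟩

theorem dyad_apply (x z : H) : (dyad x).1 z = inner ℂ x z • x := rfl

theorem quad_dyad (x z : H) : quad (dyad x).1 z = ‖inner ℂ x z‖ ^ 2 := by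
  rw [quad, dyad_apply, inner_smul_left, Complex.conj_mul']
  norm_cast

theorem dyad_zero : dyad (0 : H) = 0 := PosCone.ext_quad fun z => by
  rw [quad_dyad]; simp [quad]

theorem dyad_smul (c : ℂ) (x : H) : (dyad (c • x)).1 = ‖c‖ ^ 2 • (dyad x).1 := by
  have h : (0 : H →L[ℂ] H) ≤ ‖c‖ ^ 2 • (dyad x).1 := smul_nonneg (sq_nonneg _) (dyad x).2
  refine congrArg Subtype.val (PosCone.ext_quad (B := ⟨_, h⟩) fun z => ?_)
  rw [quad_smul, quad_dyad, quad_dyad, inner_smul_left, norm_mul, mul_pow]; simp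

theorem dyad_eq_zero {x : H} : dyad x = 0 ↔ x = 0 := by
  refine ⟨fun h => ?_, fun h => by rw [h, dyad_zero]⟩
  have := congrArg (fun A : PosCone H => quad A.1 x) h
  simp only [quad_dyad] at this
  simpa [quad] using this

/-- The multiple of a positive operator by a nonnegative real number. -/
noncomputable def scale (c : ℝ≥0) (A : PosCone H) : PosCone H :=
  ⟨(c : ℝ) • A.1, smul_nonneg c.2 A.2⟩

theorem quad_scale (c : ℝ≥0) (A : PosCone H) (z : H) :
    quad (scale c A).1 z = c * quad A.1 z := quad_smul _ _ _

theorem scale_scale (c d : ℝ≥0) (A : PosCone H) : scale c (scale d A) = scale (c * d) A :=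
  PosCone.ext_quad fun z => by simp only [quad_scale]; push_cast; ring

theorem scale_one (A : PosCone H) : scale 1 A = A :=
  PosCone.ext_quad fun z => by simp [quad_scale]

theorem scale_zero_left (A : PosCone H) : scale 0 A = 0 :=
  PosCone.ext_quad fun z => by rw [quad_scale]; simp [quad]

theorem scale_zero_right (c : ℝ≥0) : scale c (0 : PosCone H) = 0 :=
  PosCone.ext_quad fun z => by rw [quad_scale]; simp [quad]

theorem scale_add_left (c d : ℝ≥0) (A : PosCone H) : scale (c + d) A = scale c A + scale d A :=
  PosCone.ext_quad fun z => by
    change _ = quad (_ + _) z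
    rw [quad_add]; simp only [quad_scale]; push_cast; ring

theorem scale_mono {c d : ℝ≥0} (h : c ≤ d) (A : PosCone H) : scale c A ≤ scale d A :=
  PosCone.le_iff.mpr fun z => by
    rw [quad_scale, quad_scale]; exact mul_le_mul_of_nonneg_right h (quad_nonneg A.2 z)

theorem scale_le_scale {c : ℝ≥0} {A B : PosCone H} (h : A ≤ B) : scale c A ≤ scale c B :=
  PosCone.le_iff.mpr fun z => by
    rw [quad_scale, quad_scale]; exact mul_le_mul_of_nonneg_left (PosCone.le_iff.mp h z) c.2

theorem scale_le_iff {c : ℝ≥0} (hc : c ≠ 0) {A B : PosCone H} :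
    scale c A ≤ B ↔ A ≤ scale c⁻¹ B := by
  constructor <;> intro h
  · simpa [scale_scale, inv_mul_cancel₀ hc, scale_one] using scale_le_scale (c := c⁻¹) h
  · simpa [scale_scale, mul_inv_cancel₀ hc, scale_one] using scale_le_scale (c := c) h

theorem scale_dyad (c : ℝ≥0) (x : H) :
    scale c (dyad x) = dyad (((Real.sqrt c : ℝ) : ℂ) • x) := by
  refine Subtype.ext ?_
  rw [dyad_smul, Complex.norm_real, Real.norm_eq_abs, sq_abs, Real.sq_sqrt c.coe_nonneg]; rfl

/-- The Cauchy–Schwarz inequality as an operator inequality: `A z ⊗ A z ≤ ⟪A z, z⟫ A`. -/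
theorem dyad_apply_le (A : PosCone H) (z : H) :
    dyad (A.1 z) ≤ scale (quad A.1 z).toNNReal A :=
  PosCone.le_iff.mpr fun y => by
    rw [quad_dyad, quad_scale, Real.coe_toNNReal _ (quad_nonneg A.2 z)]
    exact norm_inner_sq_le A.2 z y

/-- A positive operator is determined, together with the order, by the dyads below it. -/
theorem le_iff_dyad {A B : PosCone H} : A ≤ B ↔ ∀ x, dyad x ≤ A → dyad x ≤ B := by
  refine ⟨fun h x hx => hx.trans h, fun h => PosCone.le_iff.mpr fun z => ?_⟩
  rcases (quad_nonneg A.2 z).eq_or_lt with h0 | h0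
  · rw [← h0]; exact quad_nonneg B.2 z
  set q := quad A.1 z with hq
  have hn : q.toNNReal⁻¹ ≠ 0 := inv_ne_zero (by simpa using h0)
  have h1 : scale q.toNNReal⁻¹ (dyad (A.1 z)) ≤ A := by
    rw [scale_le_iff hn, inv_inv]; exact dyad_apply_le A z
  rw [scale_dyad] at h1
  have h2 := h _ h1
  rw [← scale_dyad] at h2
  have h3 := PosCone.le_iff.mp h2 z
  rw [quad_scale, quad_dyad, quad_eq_inner A.2, ← hq, Complex.norm_real, Real.norm_eq_abs,
    sq_abs] at h3
  have : (q.toNNReal⁻¹ : ℝ≥0) * q ^ 2 = q := by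
    rw [NNReal.coe_inv, Real.coe_toNNReal _ h0.le]
    field_simp
  rw [this] at h3
  exact h3

/-- A positive operator vanishing on the orthogonal complement of `x` is a multiple of `x ⊗ x`. -/
theorem exists_scale_of_ker {C : PosCone H} {x : H} (hx : x ≠ 0)
    (hker : ∀ z, inner ℂ x z = 0 → C.1 z = 0) : ∃ c : ℝ≥0, C = scale c (dyad x) := by
  have hnx : (‖x‖ : ℂ) ≠ 0 := by simpa using hx
  have hnx' : ‖x‖ ≠ 0 := by simpa using hx
  have hq0 : 0 ≤ quad C.1 x / ‖x‖ ^ 4 := div_nonneg (quad_nonneg C.2 x) (by positivity)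
  refine ⟨(quad C.1 x / ‖x‖ ^ 4).toNNReal, PosCone.ext_quad fun y => ?_⟩
  rw [quad_scale, quad_dyad, Real.coe_toNNReal _ hq0]
  set a : ℂ := inner ℂ x y / (‖x‖ : ℂ) ^ 2 with ha
  set z : H := y - a • x with hz
  have hxz : inner ℂ x z = 0 := by
    rw [hz, inner_sub_right, inner_smul_right, inner_self_eq_norm_sq_to_K, ha]
    simp only [Complex.coe_algebraMap]
    field_simp; simp
  have hy : y = a • x + z := by rw [hz]; abel
  have hCy : C.1 y = C.1 (a • x) := by rw [hy, map_add, hker z hxz, add_zero]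
  have : quad C.1 y = quad C.1 (a • x) := by
    have h3 : inner ℂ (C.1 (a • x)) z = 0 := by
      rw [inner_apply_comm C.2, hker z hxz, inner_zero_right]
    rw [quad, hCy, hy, inner_add_right, h3, add_zero]; rfl
  rw [this, quad_smul_vec, ha, norm_div, norm_pow, Complex.norm_real, norm_norm]
  field_simp

theorem exists_scale_of_le_dyad {C : PosCone H} {x : H} (h : C ≤ dyad x) :
    ∃ c : ℝ≥0, C = scale c (dyad x) := by
  by_cases hx : x = 0
  · subst hx
    rw [dyad_zero] at h
    exact ⟨0, by rw [scale_zero_left]; exact le_antisymm h C.2⟩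
  refine exists_scale_of_ker hx fun z hz => apply_eq_zero_of_quad C.2
    (le_antisymm ?_ (quad_nonneg C.2 z))
  have := PosCone.le_iff.mp h z
  rwa [quad_dyad, hz, norm_zero, zero_pow two_ne_zero] at this

/-- A nonzero element of the cone spanning an extreme ray: everything below it is a multiple. -/
def IsRay (A : PosCone H) : Prop := A ≠ 0 ∧ ∀ C ≤ A, ∃ c : ℝ≥0, C = scale c A

/-- A nonzero positive operator has a dyad `x ⊗ x ≠ 0` below it. -/
theorem exists_dyad_le {A : PosCone H} (hA : A ≠ 0) : ∃ x : H, x ≠ 0 ∧ dyad x ≤ A := by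
  by_contra! h
  refine hA (le_antisymm (le_iff_dyad.mpr fun x hx => ?_) A.2)
  by_cases h0 : x = 0
  · rw [h0, dyad_zero]
  · exact absurd hx (h x h0)

/-- The extreme rays of the cone are spanned by the dyads. -/
theorem isRay_iff {A : PosCone H} : IsRay A ↔ ∃ x : H, x ≠ 0 ∧ A = dyad x := by
  constructor
  · rintro ⟨h0, h⟩
    obtain ⟨x, hx, hxA⟩ := exists_dyad_le h0
    obtain ⟨c, hc⟩ := h _ hxA
    have hc0 : c ≠ 0 := by
      rintro rfl
      rw [scale_zero_left, dyad_eq_zero] at hc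
      exact hx hc
    have hA : A = scale c⁻¹ (dyad x) := by
      rw [hc, scale_scale, inv_mul_cancel₀ hc0, scale_one]
    rw [scale_dyad] at hA
    refine ⟨_, fun h1 => h0 ?_, hA⟩
    rw [hA, h1, dyad_zero]
  · rintro ⟨x, hx, rfl⟩
    exact ⟨fun h => hx (dyad_eq_zero.mp h), fun C hC => exists_scale_of_le_dyad hC⟩

/-- Dyads agree exactly when their vectors agree up to a phase. -/
theorem dyad_eq_dyad_iff {x y : H} : dyad x = dyad y ↔ ∃ c : ℂ, ‖c‖ = 1 ∧ y = c • x := by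
  constructor
  · intro h
    by_cases hy : y = 0
    · rw [hy, dyad_zero, dyad_eq_zero] at h
      exact ⟨1, by simp, by rw [hy, h, smul_zero]⟩
    have h1 : inner ℂ x y • x = inner ℂ y y • y :=
      congrArg (fun A : PosCone H => A.1 y) h
    have hyy : inner ℂ y y ≠ 0 := inner_self_ne_zero.mpr hy
    set c : ℂ := (inner ℂ y y)⁻¹ * inner ℂ x y with hc
    have h2 : y = c • x := by
      rw [hc, mul_smul, h1, smul_smul, inv_mul_cancel₀ hyy, one_smul]
    refine ⟨c, ?_, h2⟩
    have hx : x ≠ 0 := by rintro rfl; exact hy (by rw [h2, smul_zero])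
    have h3 := congrArg (fun A : PosCone H => quad A.1 x) h
    simp only [quad_dyad] at h3
    rw [h2, inner_smul_left, norm_mul, mul_pow, RCLike.norm_conj] at h3
    have h4 : ‖inner ℂ x x‖ ^ 2 ≠ 0 := by simpa using hx
    have h5 : ‖c‖ ^ 2 = 1 := by
      apply mul_right_cancel₀ h4; rw [one_mul, ← h3]
    exact (pow_eq_one_iff_of_nonneg (norm_nonneg c) two_ne_zero).mp h5
  · rintro ⟨c, hc, rfl⟩
    refine Subtype.ext ?_
    rw [dyad_smul, hc, one_pow, one_smul]

/-! ### The variational description of the harmonic mean -/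

theorem quad_add_vec {A : H →L[ℂ] H} (hA : 0 ≤ A) (x h : H) :
    quad A (x + h) = quad A x + 2 * (inner ℂ (A x) h).re + quad A h := by
  have : (inner ℂ (A h) x).re = (inner ℂ (A x) h).re := by
    rw [inner_apply_comm hA, ← inner_conj_symm, Complex.conj_re]
  simp only [quad, map_add, inner_add_left, inner_add_right, Complex.add_re, this]
  ring

theorem quad_zero_vec (A : H →L[ℂ] H) : quad A 0 = 0 := by simp [quad]

theorem quad_invHarmonicMean {A B : H →L[ℂ] H} (hA : IsStrictlyPositive A)
    (hB : IsStrictlyPositive B) (z : H) :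
    (∀ y, quad (invHarmonicMean A B) z ≤ 2 * (quad A (z - y) + quad B y)) ∧
      ∃ y, quad (invHarmonicMean A B) z = 2 * (quad A (z - y) + quad B y) := by
  have hS : IsStrictlyPositive (Ring.inverse A + Ring.inverse B) :=
    (inverse_strictlyPositive hA).add_nonneg (inverse_strictlyPositive hB).nonneg
  set S := Ring.inverse A + Ring.inverse B with hSdef
  -- The minimum over the splittings `z = x₁ + x₂` is attained where `A x₁ = B x₂`.
  set w := Ring.inverse S z with hw
  set x₁ := Ring.inverse A w with hx₁
  set x₂ := Ring.inverse B w with hx₂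
  have hz : x₁ + x₂ = z := by
    have : S (Ring.inverse S z) = z := by
      rw [← mul_apply_eq_comp, Ring.mul_inverse_cancel _ hS.isUnit]; rfl
    rw [← hw] at this
    exact this
  have h₁ : A x₁ = w := by
    rw [hx₁, ← mul_apply_eq_comp, Ring.mul_inverse_cancel _ hA.isUnit]; rfl
  have h₂ : B x₂ = w := by
    rw [hx₂, ← mul_apply_eq_comp, Ring.mul_inverse_cancel _ hB.isUnit]; rfl
  have hP : quad (invHarmonicMean A B) z = 2 * (quad A x₁ + quad B x₂) := by
    rw [invHarmonicMean, quad_smul, quad, quad, quad, h₁, h₂, ← hSdef, ← hw]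
    conv_lhs => rw [← hz, inner_add_right, Complex.add_re]
  rw [hP]
  refine ⟨fun y => ?_, x₂, by rw [← hz, add_sub_cancel_right]⟩
  have e₁ := quad_add_vec hA.nonneg x₁ (x₂ - y)
  have e₂ := quad_add_vec hB.nonneg x₂ (-(x₂ - y))
  rw [h₁, show x₁ + (x₂ - y) = z - y by rw [← hz]; abel] at e₁
  rw [h₂, show x₂ + -(x₂ - y) = y by abel, inner_neg_right, Complex.neg_re] at e₂
  have := quad_nonneg hA.nonneg (x₂ - y)
  have := quad_nonneg hB.nonneg (-(x₂ - y))
  rw [e₁, e₂]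
  linarith

theorem quad_shift (A : H →L[ℂ] H) (ε : ℝ) (z : H) :
    quad (shift A ε) z = quad A z + ε * ‖z‖ ^ 2 := by
  rw [shift, quad_add, Algebra.algebraMap_eq_smul_one, quad_smul, quad_one]

theorem tendsto_quad_harmonicMean (A B : PosCone H) (z : H) :
    Tendsto (fun ε : ℝ => quad (invHarmonicMean (shift A.1 ε) (shift B.1 ε)) z) (𝓝[>] 0)
      (𝓝 (quad (harmonicMean A B).1 z)) :=
  (Complex.continuous_re.tendsto _).comp
    (((exists_harmonicMean A B).choose_spec z).inner tendsto_const_nhds)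

theorem quad_harmonicMean_le (A B : PosCone H) (z y : H) :
    quad (harmonicMean A B).1 z ≤ 2 * (quad A.1 (z - y) + quad B.1 y) := by
  have hlim : Tendsto (fun ε : ℝ => 2 * ((quad A.1 (z - y) + ε * ‖z - y‖ ^ 2) +
      (quad B.1 y + ε * ‖y‖ ^ 2))) (𝓝[>] 0) (𝓝 (2 * (quad A.1 (z - y) + quad B.1 y))) := by
    have : Continuous fun ε : ℝ => 2 * ((quad A.1 (z - y) + ε * ‖z - y‖ ^ 2) +
      (quad B.1 y + ε * ‖y‖ ^ 2)) := by fun_prop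
    simpa using (this.tendsto 0).mono_left nhdsWithin_le_nhds
  refine le_of_tendsto_of_tendsto (tendsto_quad_harmonicMean A B z) hlim ?_
  filter_upwards [self_mem_nhdsWithin] with ε hε
  rw [← quad_shift, ← quad_shift]
  exact (quad_invHarmonicMean (shift_strictlyPositive A.2 hε)
    (shift_strictlyPositive B.2 hε) z).1 y

theorem le_quad_harmonicMean (A B : PosCone H) (z : H) {m : ℝ}
    (h : ∀ y, m ≤ 2 * (quad A.1 (z - y) + quad B.1 y)) : m ≤ quad (harmonicMean A B).1 z := by
  refine ge_of_tendsto (tendsto_quad_harmonicMean A B z) ?_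
  filter_upwards [self_mem_nhdsWithin] with ε hε
  have hε : 0 < ε := hε
  obtain ⟨y, hy⟩ := (quad_invHarmonicMean (shift_strictlyPositive A.2 hε)
    (shift_strictlyPositive B.2 hε) z).2
  rw [hy, quad_shift, quad_shift]
  have := h y
  have : 0 ≤ ε * ‖z - y‖ ^ 2 := by positivity
  have : 0 ≤ ε * ‖y‖ ^ 2 := by positivity
  linarith

theorem harmonicMean_of_strictlyPositive {A B : PosCone H} (hA : IsStrictlyPositive A.1)
    (hB : IsStrictlyPositive B.1) : (harmonicMean A B).1 = invHarmonicMean A.1 B.1 := by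
  refine congrArg Subtype.val (PosCone.ext_quad
    (B := ⟨invHarmonicMean A.1 B.1, invHarmonicMean_nonneg hA hB⟩) fun z => ?_)
  obtain ⟨h1, y, hy⟩ := quad_invHarmonicMean hA hB z
  exact le_antisymm (hy ▸ quad_harmonicMean_le A B z y) (le_quad_harmonicMean A B z h1)

theorem harmonicMean_self (A : PosCone H) : harmonicMean A A = A := by
  refine PosCone.ext_quad fun z => le_antisymm ?_ (le_quad_harmonicMean A A z fun y => ?_)
  · have h := quad_harmonicMean_le A A z ((2⁻¹ : ℂ) • z)
    have e : z - (2⁻¹ : ℂ) • z = (2⁻¹ : ℂ) • z := by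
      rw [sub_eq_iff_eq_add, ← add_smul]; norm_num
    rw [e, quad_smul_vec] at h
    norm_num at h
    linarith
  · have h1 := quad_add_vec A.2 (z - y) y
    have h2 := quad_add_vec A.2 (z - y) (-y)
    have h3 := quad_nonneg A.2 (z - y + -y)
    have h4 : quad A.1 (-y) = quad A.1 y := by simp [quad]
    rw [sub_add_cancel] at h1
    rw [inner_neg_right, Complex.neg_re] at h2
    linarith

theorem harmonicMean_mono {A B C D : PosCone H} (h₁ : A ≤ C) (h₂ : B ≤ D) :
    harmonicMean A B ≤ harmonicMean C D :=
  PosCone.le_iff.mpr fun z => le_quad_harmonicMean C D z fun y => by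
    have := quad_harmonicMean_le A B z y
    have := PosCone.le_iff.mp h₁ (z - y)
    have := PosCone.le_iff.mp h₂ y
    linarith

theorem harmonicMean_le_left (A B : PosCone H) : harmonicMean A B ≤ scale 2 A :=
  PosCone.le_iff.mpr fun z => by
    have := quad_harmonicMean_le A B z 0
    rw [quad_zero_vec, sub_zero, add_zero] at this
    rwa [quad_scale]

theorem harmonicMean_le_right (A B : PosCone H) : harmonicMean A B ≤ scale 2 B :=
  PosCone.le_iff.mpr fun z => by
    have := quad_harmonicMean_le A B z z
    rw [sub_self, quad_zero_vec, zero_add] at this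
    rwa [quad_scale]

theorem zero_harmonicMean (B : PosCone H) : harmonicMean 0 B = 0 :=
  le_antisymm ((harmonicMean_le_left 0 B).trans_eq (scale_zero_right 2)) (harmonicMean 0 B).2

theorem harmonicMean_zero (A : PosCone H) : harmonicMean A 0 = 0 :=
  le_antisymm ((harmonicMean_le_right A 0).trans_eq (scale_zero_right 2)) (harmonicMean A 0).2

/-- The harmonic mean with a dyad detects whether the dyad lies below an operator. -/
theorem dyad_le_iff_harmonicMean (x : H) (B : PosCone H) :
    dyad x ≤ B ↔ dyad x ≤ harmonicMean (dyad x) B := by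
  constructor
  · intro h
    simpa [harmonicMean_self] using harmonicMean_mono (le_refl (dyad x)) h
  · intro h
    refine PosCone.le_iff.mpr fun y => ?_
    -- `α = 2` maximizes `α² - 2 (α - 1)²`.
    have h1 := PosCone.le_iff.mp h ((2 : ℂ) • y)
    have h2 := quad_harmonicMean_le (dyad x) B ((2 : ℂ) • y) y
    rw [show (2 : ℂ) • y - y = y by rw [two_smul]; abel] at h2
    rw [quad_smul_vec] at h1
    norm_num at h1
    linarith

theorem harmonicMean_scale_dyad {t s : ℝ≥0} (ht : t ≠ 0) (hs : s ≠ 0) (x : H) :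
    harmonicMean (scale t (dyad x)) (scale s (dyad x)) =
      scale (2 * t * s / (t + s)) (dyad x) := by
  have ht' : 0 < (t : ℝ) := by positivity
  have hs' : 0 < (s : ℝ) := by positivity
  refine PosCone.ext_quad fun z => le_antisymm ?_ (le_quad_harmonicMean _ _ z fun y => ?_)
  · have h := quad_harmonicMean_le (scale t (dyad x)) (scale s (dyad x)) z
      (((t / (t + s) : ℝ) : ℂ) • z)
    have e : z - ((t / (t + s) : ℝ) : ℂ) • z = ((s / (t + s) : ℝ) : ℂ) • z := by
      rw [sub_eq_iff_eq_add, ← add_smul, ← Complex.ofReal_add, ← add_div, add_comm (s : ℝ),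
        div_self (by positivity), Complex.ofReal_one, one_smul]
    rw [e, quad_smul_vec, quad_smul_vec, Complex.norm_real, Complex.norm_real] at h
    refine h.trans (le_of_eq ?_)
    simp only [quad_scale, Real.norm_eq_abs, sq_abs]
    push_cast
    field_simp
    ring
  · simp only [quad_scale, quad_dyad, inner_sub_right]
    set a := inner ℂ x z
    set b := inner ℂ x y
    have h1 : ‖a‖ ≤ ‖a - b‖ + ‖b‖ := by simpa using norm_add_le (a - b) b
    have h2 : ‖a‖ ^ 2 ≤ (‖a - b‖ + ‖b‖) ^ 2 := by gcongr
    push_cast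
    rw [div_mul_eq_mul_div, div_le_iff₀ (by positivity)]
    have h3 := mul_le_mul_of_nonneg_left h2 (mul_pos ht' hs').le
    nlinarith [sq_nonneg ((t : ℝ) * ‖a - b‖ - s * ‖b‖)]

/-- The harmonic mean is compatible with every congruence `A ↦ K A`, described by
`⟪(K A) z, z⟫ = ⟪A (s z), s z⟫` with `s` additive and onto. -/
theorem harmonicMean_congruence {K : PosCone H → PosCone H} {s : H → H}
    (hK : ∀ A z, quad (K A).1 z = quad A.1 (s z)) (hs : ∀ a b, s (a - b) = s a - s b)
    (hsurj : Function.Surjective s) (A B : PosCone H) :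
    harmonicMean (K A) (K B) = K (harmonicMean A B) := by
  refine PosCone.ext_quad fun z => le_antisymm ?_ (le_quad_harmonicMean _ _ z fun y => ?_)
  · rw [hK]
    refine le_quad_harmonicMean _ _ _ fun y => ?_
    obtain ⟨y, rfl⟩ := hsurj y
    rw [← hs, ← hK, ← hK]
    exact quad_harmonicMean_le _ _ _ _
  · rw [hK, hK, hK, hs]
    exact quad_harmonicMean_le _ _ _ _

/-! ### Homogeneous order automorphisms of the cone -/

/-- A nonnegative additive function on `[0, ∞)` is linear. -/
theorem additive_eq_mul {h : ℝ≥0 → ℝ} (h0 : ∀ t, 0 ≤ h t) (hadd : ∀ a b, h (a + b) = h a + h b)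
    (t : ℝ≥0) : h t = t * h 1 := by
  have hmono : ∀ a b, a ≤ b → h a ≤ h b := fun a b hab => by
    rw [← add_tsub_cancel_of_le hab, hadd]
    linarith [h0 (b - a)]
  have hz : h 0 = 0 := by
    have := hadd 0 0
    rw [add_zero] at this
    linarith
  have hn : ∀ (n : ℕ) (s : ℝ≥0), h (n * s) = n * h s := fun n s => by
    induction n with
    | zero => simp [hz]
    | succ k ih => push_cast; rw [add_mul, hadd, ih, one_mul, add_mul, one_mul]
  have key : ∀ n : ℕ, n * |h t - t * h 1| ≤ h 1 := fun n => by
    set m := ⌊(n * t : ℝ≥0)⌋₊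
    have h1 : (m : ℝ≥0) ≤ n * t := Nat.floor_le zero_le
    have h2 : (n * t : ℝ≥0) ≤ (m + 1 : ℕ) := by push_cast; exact (Nat.lt_floor_add_one _).le
    have h3 := hmono _ _ h1
    have h4 := hmono _ _ h2
    have e1 := hn m 1
    have e2 := hn (m + 1) 1
    rw [mul_one] at e1 e2
    rw [e1, hn] at h3
    rw [e2, hn] at h4
    have h1' : (m : ℝ) ≤ n * t := by exact_mod_cast h1
    have h2' : (n * t : ℝ) ≤ m + 1 := by exact_mod_cast h2
    push_cast at h4
    have h5 := mul_le_mul_of_nonneg_right h1' (h0 1)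
    have h6 := mul_le_mul_of_nonneg_right h2' (h0 1)
    rw [← Nat.abs_cast n, ← abs_mul, abs_le]
    constructor <;> linarith
  by_contra hne
  have hpos : 0 < |h t - t * h 1| := abs_pos.mpr (sub_ne_zero.mpr hne)
  obtain ⟨n, hn'⟩ := exists_nat_gt (h 1 / |h t - t * h 1|)
  rw [div_lt_iff₀ hpos] at hn'
  exact absurd (key n) (not_le.mpr hn')

/-- A positively homogeneous order automorphism of the cone `B(H)⁺`. -/
structure IsConeIso (ψ : PosCone H → PosCone H) : Prop where
  surjective : Function.Surjective ψ
  le_iff : ∀ A B, ψ A ≤ ψ B ↔ A ≤ B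
  map_scale : ∀ c A, ψ (scale c A) = scale c (ψ A)

namespace IsConeIso

variable {ψ : PosCone H → PosCone H}

theorem injective (h : IsConeIso ψ) : Function.Injective ψ := fun A B hAB =>
  le_antisymm ((h.le_iff A B).mp hAB.le) ((h.le_iff B A).mp hAB.ge)

theorem map_zero (h : IsConeIso ψ) : ψ 0 = 0 := by
  have := h.map_scale 0 0
  rwa [scale_zero_left, scale_zero_left] at this

theorem isRay_iff (h : IsConeIso ψ) (A : PosCone H) : IsRay (ψ A) ↔ IsRay A := by
  have h0 : ψ A = 0 ↔ A = 0 := ⟨fun hA => h.injective (hA.trans h.map_zero.symm),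
    fun hA => by rw [hA, h.map_zero]⟩
  refine and_congr (not_congr h0) ⟨fun hA C hC => ?_, fun hA C hC => ?_⟩
  · obtain ⟨c, hc⟩ := hA (ψ C) ((h.le_iff _ _).mpr hC)
    exact ⟨c, h.injective (by rw [hc, h.map_scale])⟩
  · obtain ⟨C, rfl⟩ := h.surjective C
    obtain ⟨c, hc⟩ := hA C ((h.le_iff _ _).mp hC)
    exact ⟨c, by rw [hc, h.map_scale]⟩

theorem exists_map_dyad (h : IsConeIso ψ) (x : H) : ∃ y, ψ (dyad x) = dyad y := by
  by_cases hx : x = 0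
  · exact ⟨0, by rw [hx, dyad_zero, h.map_zero]⟩
  · obtain ⟨y, -, hy⟩ := PowerMeans.isRay_iff.mp
      ((h.isRay_iff _).mpr (PowerMeans.isRay_iff.mpr ⟨x, hx, rfl⟩))
    exact ⟨y, hy⟩

theorem exists_dyad_preimage (h : IsConeIso ψ) (y : H) : ∃ x, ψ (dyad x) = dyad y := by
  by_cases hy : y = 0
  · exact ⟨0, by rw [hy, dyad_zero, h.map_zero]⟩
  · obtain ⟨A, hA⟩ := h.surjective (dyad y)
    obtain ⟨x, -, rfl⟩ := PowerMeans.isRay_iff.mp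
      ((h.isRay_iff A).mp (hA ▸ PowerMeans.isRay_iff.mpr ⟨y, hy, rfl⟩))
    exact ⟨x, hA⟩

/-- An order automorphism which acts on dyads by `x ⊗ x ↦ T x ⊗ T x` is the congruence by `T`;
here `s` plays the role of the adjoint of `T`. -/
theorem eq_congruence (h : IsConeIso ψ) {T s : H → H} {K : PosCone H → PosCone H}
    (hT : ∀ x, ψ (dyad x) = dyad (T x)) (hTs : ∀ x z, ‖inner ℂ (T x) z‖ = ‖inner ℂ x (s z)‖)
    (hs : Function.Surjective s) (hK : ∀ A z, quad (K A).1 z = quad A.1 (s z)) (A : PosCone H) :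
    ψ A = K A := by
  have key : ∀ y, dyad y ≤ ψ A ↔ dyad y ≤ K A := fun y => by
    obtain ⟨x, hx⟩ := h.exists_dyad_preimage y
    rw [← hx, h.le_iff, hT, PosCone.le_iff, PosCone.le_iff, hs.forall]
    simp only [quad_dyad, hK, hTs]
  exact le_antisymm (le_iff_dyad.mpr fun y => (key y).mp) (le_iff_dyad.mpr fun y => (key y).mpr)

theorem exists_continuousLinearEquiv (h : IsConeIso ψ) {σ : ℂ →+* ℂ} [RingHomInvPair σ σ]
    [RingHomIsometric σ] (T : H →ₛₗ[σ] H) (hT : ∀ x, ψ (dyad x) = dyad (T x)) :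
    ∃ T' : H ≃SL[σ] H, ∀ x, T' x = T x := by
  have hbound : ∀ x, ‖T x‖ ≤ Real.sqrt ‖(ψ 1).1‖ * ‖x‖ := fun x => by
    have h1 : dyad x ≤ scale (‖x‖₊ ^ 2) 1 := PosCone.le_iff.mpr fun z => by
      rw [quad_dyad, quad_scale]
      change _ ≤ _ * quad 1 z
      rw [quad_one]
      push_cast
      rw [← mul_pow]
      exact pow_le_pow_left₀ (norm_nonneg _) (norm_inner_le_norm _ _) 2
    have h2 := PosCone.le_iff.mp ((h.le_iff _ _).mpr h1) (T x)
    rw [hT, h.map_scale, quad_dyad, quad_scale, inner_self_eq_norm_sq_to_K] at h2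
    have h3 := quad_le_norm (ψ 1).1 (T x)
    by_cases h0 : T x = 0
    · rw [h0, norm_zero]; positivity
    have h4 : 0 < ‖T x‖ ^ 2 := by positivity
    have h5 : ‖T x‖ ^ 2 ≤ (Real.sqrt ‖(ψ 1).1‖ * ‖x‖) ^ 2 := by
      rw [mul_pow, Real.sq_sqrt (norm_nonneg _)]
      refine le_of_mul_le_mul_right ?_ h4
      calc ‖T x‖ ^ 2 * ‖T x‖ ^ 2 = ‖((‖T x‖ : ℂ)) ^ 2‖ ^ 2 := by simp; ring
        _ ≤ ‖x‖ ^ 2 * quad (ψ 1).1 (T x) := by simpa using h2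
        _ ≤ ‖x‖ ^ 2 * (‖(ψ 1).1‖ * ‖T x‖ ^ 2) := by gcongr
        _ = _ := by ring
    exact le_of_sq_le_sq h5 (by positivity)
  refine ⟨ContinuousLinearEquiv.ofBijective (T.mkContinuous _ hbound) ?_ ?_, fun x => rfl⟩
  · refine LinearMap.ker_eq_bot'.mpr fun x hx => ?_
    have hx : T x = 0 := hx
    have := hT x
    rw [hx, dyad_zero, ← h.map_zero] at this
    exact dyad_eq_zero.mp (h.injective this)
  · refine LinearMap.range_eq_top.mpr fun y => ?_
    obtain ⟨x, hx⟩ := h.exists_dyad_preimage y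
    rw [hT] at hx
    obtain ⟨c, -, rfl⟩ := dyad_eq_dyad_iff.mp hx
    refine ⟨σ c • x, ?_⟩
    change T (σ c • x) = _
    rw [map_smulₛₗ, RingHomInvPair.comp_apply_eq]

end IsConeIso

/-! ### Additive bijections of the cone -/

theorem isConeIso_of_additive {ψ : PosCone H → PosCone H} (hψ : Function.Bijective ψ)
    (hadd : ∀ A B, ψ (A + B) = ψ A + ψ B) : IsConeIso ψ := by
  have hle : ∀ A B : PosCone H, A ≤ B ↔ ∃ C, B = A + C := fun A B =>
    ⟨fun h => ⟨⟨B.1 - A.1, sub_nonneg.mpr h⟩, Subtype.ext (add_sub_cancel A.1 B.1).symm⟩,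
      fun ⟨C, hC⟩ => hC ▸ Subtype.coe_le_coe.mp (le_add_of_nonneg_right C.2)⟩
  refine ⟨hψ.2, fun A B => ?_, fun c A => PosCone.ext_quad fun z => ?_⟩
  · rw [hle, hle, hψ.2.exists]
    simp only [← hadd, hψ.1.eq_iff]
  · rw [quad_scale, additive_eq_mul (h := fun t => quad (ψ (scale t A)).1 z)
      (fun t => quad_nonneg (ψ _).2 z) (fun a b => ?_) c, scale_one]
    rw [scale_add_left, hadd]
    exact quad_add _ _ _

/-- The extension of an additive map on the cone to self-adjoint operators,
`X ↦ ψ (X⁺) - ψ (X⁻)`. It is only meaningful for self-adjoint `X`. -/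
noncomputable def realExtension (ψ : PosCone H → PosCone H) (X : H →L[ℂ] H) : H →L[ℂ] H :=
  (ψ ⟨X⁺, CFC.posPart_nonneg X⟩).1 - (ψ ⟨X⁻, CFC.negPart_nonneg X⟩).1

theorem realExtension_sub {ψ : PosCone H → PosCone H} (hadd : ∀ A B, ψ (A + B) = ψ A + ψ B)
    (P Q : PosCone H) : realExtension ψ (P.1 - Q.1) = (ψ P).1 - (ψ Q).1 := by
  have hsa : IsSelfAdjoint (P.1 - Q.1) := P.2.isSelfAdjoint.sub Q.2.isSelfAdjoint
  set X := P.1 - Q.1 with hX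
  have h1 : (⟨X⁺, CFC.posPart_nonneg X⟩ : PosCone H) + Q = P + ⟨X⁻, CFC.negPart_nonneg X⟩ := by
    refine Subtype.ext ?_
    change X⁺ + Q.1 = P.1 + X⁻
    have := CFC.posPart_sub_negPart X hsa
    rw [← sub_eq_sub_iff_add_eq_add, this, hX]
  have h2 := congrArg (fun A : PosCone H => (ψ A).1) h1
  simp only [hadd] at h2
  exact sub_eq_sub_iff_add_eq_add.mpr h2

theorem exists_eq_sub {X : H →L[ℂ] H} (hX : IsSelfAdjoint X) : ∃ P Q : PosCone H, X = P.1 - Q.1 :=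
  ⟨⟨X⁺, CFC.posPart_nonneg X⟩, ⟨X⁻, CFC.negPart_nonneg X⟩, (CFC.posPart_sub_negPart X hX).symm⟩

theorem realExtension_add {ψ : PosCone H → PosCone H} (hadd : ∀ A B, ψ (A + B) = ψ A + ψ B)
    {X Y : H →L[ℂ] H} (hX : IsSelfAdjoint X) (hY : IsSelfAdjoint Y) :
    realExtension ψ (X + Y) = realExtension ψ X + realExtension ψ Y := by
  obtain ⟨P, Q, rfl⟩ := exists_eq_sub hX
  obtain ⟨P', Q', rfl⟩ := exists_eq_sub hY
  have e : P.1 - Q.1 + (P'.1 - Q'.1) = (P + P').1 - (Q + Q').1 := by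
    change _ = (P.1 + P'.1) - (Q.1 + Q'.1)
    abel
  rw [e, realExtension_sub hadd, realExtension_sub hadd, realExtension_sub hadd, hadd, hadd]
  change ((ψ P).1 + (ψ P').1) - ((ψ Q).1 + (ψ Q').1) = _
  abel

theorem realExtension_smul {ψ : PosCone H → PosCone H} (h : IsConeIso ψ)
    (hadd : ∀ A B, ψ (A + B) = ψ A + ψ B) {X : H →L[ℂ] H} (hX : IsSelfAdjoint X) (r : ℝ) :
    realExtension ψ (r • X) = r • realExtension ψ X := by
  obtain ⟨P, Q, rfl⟩ := exists_eq_sub hX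
  rcases le_total 0 r with hr | hr
  · lift r to ℝ≥0 using hr
    have e : (r : ℝ) • (P.1 - Q.1) = (scale r P).1 - (scale r Q).1 := smul_sub _ _ _
    rw [e, realExtension_sub hadd, realExtension_sub hadd, h.map_scale, h.map_scale]
    exact (smul_sub _ _ _).symm
  · obtain ⟨s, rfl⟩ : ∃ s : ℝ≥0, r = -s := ⟨(-r).toNNReal, by
      rw [Real.coe_toNNReal _ (neg_nonneg.mpr hr), neg_neg]⟩
    have e : (-s : ℝ) • (P.1 - Q.1) = (scale s Q).1 - (scale s P).1 := by
      change _ = (s : ℝ) • Q.1 - (s : ℝ) • P.1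
      rw [neg_smul, smul_sub]; abel
    rw [e, realExtension_sub hadd, realExtension_sub hadd, h.map_scale, h.map_scale]
    change (s : ℝ) • (ψ Q).1 - (s : ℝ) • (ψ P).1 = _
    rw [neg_smul, smul_sub]; abel

theorem realExtension_isSelfAdjoint (ψ : PosCone H → PosCone H) (X : H →L[ℂ] H) :
    IsSelfAdjoint (realExtension ψ X) :=
  (ψ _).2.isSelfAdjoint.sub (ψ _).2.isSelfAdjoint

/-- A homogeneous additive map on the cone extends to a `ℂ`-linear `*`-map on all operators. -/
theorem exists_linear_extension {ψ : PosCone H → PosCone H} (h : IsConeIso ψ)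
    (hadd : ∀ A B, ψ (A + B) = ψ A + ψ B) :
    ∃ G : (H →L[ℂ] H) →ₗ[ℂ] (H →L[ℂ] H), (∀ A : PosCone H, G A.1 = (ψ A).1) ∧
      ∀ X, G (star X) = star (G X) := by
  have hsR : ∀ X : H →L[ℂ] H, IsSelfAdjoint (X + star X) := fun X => .add_star_self X
  have hsJ : ∀ X : H →L[ℂ] H, IsSelfAdjoint (Complex.I • (star X - X)) := fun X => by
    rw [IsSelfAdjoint, star_smul, star_sub, star_star, Complex.star_def, Complex.conj_I, neg_smul,
      ← smul_neg, neg_sub]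
  set F := realExtension ψ with hF
  have hneg : ∀ X, IsSelfAdjoint X → F (-X) = -F X := fun X hX => by
    have := realExtension_smul h hadd hX (-1)
    rwa [neg_one_smul, neg_one_smul] at this
  -- `X = (R + i J) / 2` with the self-adjoint operators `R = X + X*` and `J = i (X* - X)`.
  set G : (H →L[ℂ] H) → (H →L[ℂ] H) := fun X =>
    (2⁻¹ : ℂ) • (F (X + star X) + Complex.I • F (Complex.I • (star X - X))) with hG
  have Gadd : ∀ X Y, G (X + Y) = G X + G Y := fun X Y => by
    have e1 : X + Y + star (X + Y) = (X + star X) + (Y + star Y) := by rw [star_add]; abel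
    have e2 : Complex.I • (star (X + Y) - (X + Y)) =
        Complex.I • (star X - X) + Complex.I • (star Y - Y) := by
      rw [star_add, ← smul_add]; congr 1; abel
    simp only [hG]
    rw [e1, e2, hF, realExtension_add hadd (hsR X) (hsR Y),
      realExtension_add hadd (hsJ X) (hsJ Y)]
    simp only [smul_add]
    abel
  have Greal : ∀ (r : ℝ) X, G (r • X) = r • G X := fun r X => by
    have e1 : r • X + star (r • X) = r • (X + star X) := by
      rw [star_smul, star_trivial, smul_add]
    have e2 : Complex.I • (star (r • X) - r • X) = r • (Complex.I • (star X - X)) := by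
      rw [star_smul, star_trivial, ← smul_sub, smul_comm]
    simp only [hG]
    rw [e1, e2, hF, realExtension_smul h hadd (hsR X), realExtension_smul h hadd (hsJ X),
      smul_comm Complex.I r, ← smul_add, smul_comm (2⁻¹ : ℂ) r]
  have GI : ∀ X, G (Complex.I • X) = Complex.I • G X := fun X => by
    have e1 : Complex.I • X + star (Complex.I • X) = -(Complex.I • (star X - X)) := by
      rw [star_smul, Complex.star_def, Complex.conj_I, neg_smul, smul_sub]; abel
    have e2 : Complex.I • (star (Complex.I • X) - Complex.I • X) = X + star X := by
      rw [star_smul, Complex.star_def, Complex.conj_I, neg_smul, smul_sub, smul_neg, smul_smul,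
        smul_smul, Complex.I_mul_I, neg_one_smul, neg_one_smul]; abel
    simp only [hG]
    rw [e1, e2, hneg _ (hsJ X), smul_comm Complex.I (2⁻¹ : ℂ), smul_add Complex.I,
      smul_smul Complex.I Complex.I, Complex.I_mul_I, neg_one_smul, add_comm (Complex.I • _)]
  refine ⟨⟨⟨G, Gadd⟩, fun c X => ?_⟩, fun A => ?_, fun X => ?_⟩
  · change G (c • X) = c • G X
    have e : ∀ Y : H →L[ℂ] H, c • Y = c.re • Y + c.im • (Complex.I • Y) := fun Y => by
      rw [← Complex.coe_smul, ← Complex.coe_smul, smul_smul, ← add_smul, Complex.re_add_im]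
    rw [e X, e (G X), Gadd, Greal, Greal, GI]
  · change G A.1 = _
    have h0 : F 0 = 0 := by
      have := realExtension_sub hadd (0 : PosCone H) 0
      simpa using this
    have h1 := realExtension_sub hadd (A + A) 0
    rw [h.map_zero, hadd] at h1
    have h2 : F (A.1 + A.1) = (ψ A).1 + (ψ A).1 := by simpa using h1
    simp only [hG]
    rw [A.2.isSelfAdjoint.star_eq, sub_self, smul_zero, h0, smul_zero, add_zero, h2, ← two_smul ℂ,
      smul_smul]
    norm_num
  · change G (star X) = star (G X)
    have e2 : Complex.I • (X - star X) = -(Complex.I • (star X - X)) := by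
      rw [← smul_neg, neg_sub]
    simp only [hG]
    rw [star_star, e2, hneg _ (hsJ X), add_comm (star X), star_smul, star_add, star_smul,
      (realExtension_isSelfAdjoint ψ _).star_eq, (realExtension_isSelfAdjoint ψ _).star_eq,
      Complex.star_def, Complex.conj_I, smul_neg, neg_smul, map_inv₀, map_ofNat]

/-! ### Rank-one pencils -/

theorem exists_dual {u v : H} (h : ∀ c : ℂ, u ≠ c • v) :
    ∃ z : H, inner ℂ z u = 1 ∧ inner ℂ z v = 0 := by
  set w := u - (inner ℂ v u / inner ℂ v v) • v with hw
  have hw0 : w ≠ 0 := sub_ne_zero.mpr (h _)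
  have hvw : inner ℂ v w = 0 := by
    rw [hw, inner_sub_right, inner_smul_right]
    by_cases hv : v = 0
    · simp [hv]
    · rw [div_mul_cancel₀ _ (inner_self_ne_zero.mpr hv), sub_self]
  have hwv : inner ℂ w v = 0 := by rw [← inner_conj_symm, hvw, map_zero]
  have hwu : inner ℂ w u = inner ℂ w w := by
    conv_rhs => rw [hw, inner_sub_right, inner_smul_right, ← hw, hwv, mul_zero, sub_zero]
  refine ⟨(inner ℂ w w)⁻¹ • w, ?_, ?_⟩
  · rw [inner_smul_left, map_inv₀, inner_conj_symm, hwu,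
      inv_mul_cancel₀ (inner_self_ne_zero.mpr hw0)]
  · rw [inner_smul_left, hwv, mul_zero]

/-- Coefficient comparison for the determinant of the pencil in `exists_of_pencil`. -/
theorem pencil_coefficients {α β γ δ : ℂ}
    (h : ∀ t : ℂ, (1 + t * α + conj t * conj α) * (t * conj t + t * β + conj t * conj β) =
      (t * γ + conj t * conj δ) * (t * δ + conj t * conj γ)) :
    α = 0 ∧ β = 0 ∧ γ * δ = 0 ∧ γ * conj γ + δ * conj δ = 1 := by
  -- Along a real line `s ↦ s t` both sides are cubic polynomials in `s`.
  have key : ∀ t : ℂ, t * α + conj t * conj α = 0 ∧ t * β + conj t * conj β = 0 ∨ t = 0 := by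
    intro t
    by_cases ht : t = 0
    · exact Or.inr ht
    left
    have h1 := h t
    have h2 := h (-t)
    have h3 := h (2 * t)
    simp only [map_neg, map_mul, map_ofNat] at h2 h3
    have hA : (t * α + conj t * conj α) * (t * conj t) = 0 := by
      linear_combination (1 / 6 : ℂ) * h3 - (1 / 2 : ℂ) * h1 - (1 / 6 : ℂ) * h2
    have hB : t * β + conj t * conj β = 0 := by
      linear_combination h1 - (1 / 3 : ℂ) * h2 - (1 / 6 : ℂ) * h3
    have htt : t * conj t ≠ 0 := mul_ne_zero ht (by simpa using ht)
    exact ⟨(mul_eq_zero.mp hA).resolve_right htt, hB⟩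
  have solve : ∀ a : ℂ, (∀ t : ℂ, t * a + conj t * conj a = 0 ∨ t = 0) → a = 0 := fun a ha => by
    have h1 := (ha 1).resolve_right one_ne_zero
    have h2 := (ha Complex.I).resolve_right Complex.I_ne_zero
    simp only [map_one, one_mul, Complex.conj_I] at h1 h2
    have h3 : Complex.I * (a - conj a) = 0 := by linear_combination h2
    have h4 := (mul_eq_zero.mp h3).resolve_left Complex.I_ne_zero
    linear_combination (1 / 2 : ℂ) * h1 + (1 / 2 : ℂ) * h4
  have hα : α = 0 := solve α fun t => (key t).imp_left And.left
  have hβ : β = 0 := solve β fun t => (key t).imp_left And.right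
  subst hα hβ
  have hm : ∀ t : ℂ, t * conj t = t ^ 2 * (γ * δ) + conj t ^ 2 * (conj γ * conj δ) +
      t * conj t * (γ * conj γ + δ * conj δ) := fun t => by
    have := h t
    rw [map_zero] at this
    linear_combination this
  have h1 := hm 1
  have h2 := hm Complex.I
  have h3 := hm (1 + Complex.I)
  simp only [map_one, map_add, Complex.conj_I] at h1 h2 h3
  have hI : Complex.I ^ 2 = -1 := Complex.I_sq
  have h4 : γ * conj γ + δ * conj δ = 1 := by
    linear_combination (-1 / 2 : ℂ) * h1 - (1 / 2 : ℂ) * h2 - (1 / 2 : ℂ) *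
      (γ * δ + conj γ * conj δ - (γ * conj γ + δ * conj δ) + 1) * hI
  have h5 : Complex.I * (γ * δ - conj γ * conj δ) = 0 := by
    linear_combination (-1 / 2 : ℂ) * h3 - h4 + (1 / 2 : ℂ) * (-1 - γ * δ - conj γ * conj δ +
      (γ * conj γ + δ * conj δ)) * hI
  have h6 := (mul_eq_zero.mp h5).resolve_left Complex.I_ne_zero
  refine ⟨rfl, rfl, ?_, h4⟩
  linear_combination (1 / 2 : ℂ) * h6 - (1 / 2 : ℂ) * h1 - (1 / 2 : ℂ) * h4

/-- If the pencil `u ⊗ u + t X + t̄ X* + |t|² v ⊗ v` is a dyad for every complex `t`, with `u` and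
`v` linearly independent, then, after a change of the phase of `v`, it is the pencil of
`u + t v` or that of `u + t̄ v`. -/
theorem exists_of_pencil {u v : H} (hu : ∀ c : ℂ, u ≠ c • v) (hv : ∀ c : ℂ, v ≠ c • u)
    {X : H →L[ℂ] H}
    (hX : ∀ t : ℂ, ∃ g, (dyad u).1 + t • X + conj t • star X + (t * conj t) • (dyad v).1 =
      (dyad g).1) :
    ∃ w, dyad w = dyad v ∧ (X = rankOne ℂ w u ∨ X = rankOne ℂ u w) := by
  obtain ⟨z₁, hu1, hv1⟩ := exists_dual hu
  obtain ⟨z₂, hv2, hu2⟩ := exists_dual hv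
  -- The matrix elements of the pencil are those of a dyad.
  have hX' : ∀ t : ℂ, ∃ g, ∀ a b, inner ℂ a u * inner ℂ u b + t * inner ℂ a (X b) +
      conj t * conj (inner ℂ b (X a)) + t * conj t * (inner ℂ a v * inner ℂ v b) =
      inner ℂ a g * inner ℂ g b := fun t => by
    obtain ⟨g, hg⟩ := hX t
    refine ⟨g, fun a b => ?_⟩
    have h1 := congrArg (fun A : H →L[ℂ] H => inner ℂ a (A b)) hg
    simp only [add_apply, smul_apply, inner_add_right, inner_smul_right,
      dyad_apply, ContinuousLinearMap.star_eq_adjoint, ContinuousLinearMap.adjoint_inner_right] at h1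
    rw [inner_conj_symm]
    linear_combination h1
  -- Vectors orthogonal to `u` and `v` lie in the kernels of `X` and `X*`.
  have hker : ∀ z, inner ℂ z u = 0 → inner ℂ z v = 0 →
      ∀ a, inner ℂ a (X z) = 0 ∧ inner ℂ z (X a) = 0 := fun z hzu hzv a => by
    have hsq : ∀ t : ℂ, ∃ r : ℝ, 0 ≤ r ∧ t * inner ℂ z (X z) + conj t * conj (inner ℂ z (X z)) = r ∧
        (r = 0 → t * inner ℂ a (X z) + conj t * conj (inner ℂ z (X a)) = 0) := fun t => by
      obtain ⟨g, hg⟩ := hX' t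
      have h1 := hg z z
      have h2 := hg a z
      have hvz : inner ℂ v z = 0 := by rw [← inner_conj_symm, hzv, map_zero]
      have huz : inner ℂ u z = 0 := by rw [← inner_conj_symm, hzu, map_zero]
      rw [hzu, hzv, ← inner_conj_symm g z, Complex.mul_conj' (inner ℂ z g)] at h1
      rw [huz, hvz] at h2
      refine ⟨‖inner ℂ z g‖ ^ 2, sq_nonneg _, ?_, fun h0 => ?_⟩
      · push_cast
        linear_combination h1
      · have h3 : inner ℂ g z = 0 := by
          rw [← inner_conj_symm, norm_eq_zero.mp (pow_eq_zero_iff two_ne_zero |>.mp h0), map_zero]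
        rw [h3] at h2
        linear_combination h2
    have hzero : ∀ t : ℂ, t * inner ℂ a (X z) + conj t * conj (inner ℂ z (X a)) = 0 := fun t => by
      obtain ⟨r, hr, h1, h2⟩ := hsq t
      obtain ⟨r', hr', h1', -⟩ := hsq (-t)
      have h3 : (r : ℂ) + r' = 0 := by
        rw [← h1, ← h1', map_neg]; ring
      have h4 : r + r' = 0 := by exact_mod_cast h3
      exact h2 (by linarith)
    have h1 := hzero 1
    have h2 := hzero Complex.I
    simp only [map_one, one_mul, Complex.conj_I] at h1 h2
    have h3 : inner ℂ a (X z) = 0 := by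
      linear_combination (1 / 2 : ℂ) * h1 - (1 / 2 : ℂ) * Complex.I * h2 +
        (1 / 2 : ℂ) * (inner ℂ a (X z) - conj (inner ℂ z (X a))) * Complex.I_mul_I
    rw [h3, zero_add] at h1
    exact ⟨h3, (map_eq_zero (starRingEnd ℂ)).mp h1⟩
  set α := inner ℂ z₁ (X z₁) with hα
  set β := inner ℂ z₂ (X z₂) with hβ
  set γ := inner ℂ z₁ (X z₂) with hγ
  set δ := inner ℂ z₂ (X z₁) with hδ
  have h1u : inner ℂ u z₁ = 1 := by rw [← inner_conj_symm, hu1, map_one]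
  have h1v : inner ℂ v z₁ = 0 := by rw [← inner_conj_symm, hv1, map_zero]
  have h2u : inner ℂ u z₂ = 0 := by rw [← inner_conj_symm, hu2, map_zero]
  have h2v : inner ℂ v z₂ = 1 := by rw [← inner_conj_symm, hv2, map_one]
  have hdet : ∀ t : ℂ, (1 + t * α + conj t * conj α) * (t * conj t + t * β + conj t * conj β) =
      (t * γ + conj t * conj δ) * (t * δ + conj t * conj γ) := fun t => by
    obtain ⟨g, hg⟩ := hX' t
    have h11 := hg z₁ z₁
    have h22 := hg z₂ z₂
    have h12 := hg z₁ z₂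
    have h21 := hg z₂ z₁
    simp only [hu1, hv1, hu2, hv2, h1u, h1v, h2u, h2v, ← hα, ← hβ, ← hγ, ← hδ] at h11 h22 h12 h21
    have e : (inner ℂ z₁ g * inner ℂ g z₁) * (inner ℂ z₂ g * inner ℂ g z₂) =
        (inner ℂ z₁ g * inner ℂ g z₂) * (inner ℂ z₂ g * inner ℂ g z₁) := by ring
    rw [← h11, ← h22, ← h12, ← h21] at e
    linear_combination e
  obtain ⟨hα0, hβ0, hγδ, hn⟩ := pencil_coefficients hdet
  -- `X` is determined by its four matrix elements.
  have hform : ∀ a b, inner ℂ a (X b) = inner ℂ a u * inner ℂ v b * γ +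
      inner ℂ a v * inner ℂ u b * δ := fun a b => by
    have split : ∀ c : H, ∃ c₀, inner ℂ c₀ u = 0 ∧ inner ℂ c₀ v = 0 ∧
        c = inner ℂ u c • z₁ + inner ℂ v c • z₂ + c₀ := fun c => by
      refine ⟨c - (inner ℂ u c • z₁ + inner ℂ v c • z₂), ?_, ?_, by abel⟩ <;>
      simp only [inner_sub_left, inner_add_left, inner_smul_left, hu1, hv1, hu2, hv2,
        inner_conj_symm] <;> ring
    obtain ⟨a₀, ha1, ha2, ha⟩ := split a
    obtain ⟨b₀, hb1, hb2, hb⟩ := split b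
    have e1 : inner ℂ a (X b) = inner ℂ a (X (inner ℂ u b • z₁ + inner ℂ v b • z₂)) := by
      conv_lhs => rw [hb, map_add, inner_add_right, (hker b₀ hb1 hb2 a).1, add_zero]
    have e2 : ∀ y, inner ℂ a (X y) = inner ℂ (inner ℂ u a • z₁ + inner ℂ v a • z₂) (X y) :=
      fun y => by
        conv_lhs => rw [ha, inner_add_left, (hker a₀ ha1 ha2 y).2, add_zero]
    rw [e1, e2]
    simp only [map_add, map_smul, inner_add_left, inner_add_right, inner_smul_left,
      inner_smul_right, inner_conj_symm, ← hα, ← hβ, ← hγ, ← hδ, hα0, hβ0]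
    ring
  have hphase : ∀ c : ℂ, c * conj c = 1 → ‖c‖ = 1 := fun c hc => by
    rw [Complex.mul_conj'] at hc
    have : ‖c‖ ^ 2 = 1 := by exact_mod_cast hc
    exact (pow_eq_one_iff_of_nonneg (norm_nonneg c) two_ne_zero).mp this
  rcases mul_eq_zero.mp hγδ with h0 | h0
  · rw [h0, zero_mul, zero_add] at hn
    refine ⟨δ • v, (dyad_eq_dyad_iff.mpr ⟨δ, hphase _ hn, rfl⟩).symm, Or.inl ?_⟩
    refine ContinuousLinearMap.ext fun b => ext_inner_left ℂ fun a => ?_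
    rw [hform, h0, InnerProductSpace.rankOne_apply, inner_smul_right, inner_smul_right]
    ring
  · rw [h0, zero_mul, add_zero] at hn
    refine ⟨conj γ • v, (dyad_eq_dyad_iff.mpr ⟨conj γ, by rw [RCLike.norm_conj, hphase _ hn],
      rfl⟩).symm, Or.inr ?_⟩
    refine ContinuousLinearMap.ext fun b => ext_inner_left ℂ fun a => ?_
    rw [hform, h0, InnerProductSpace.rankOne_apply, inner_smul_right, inner_smul_left,
      Complex.conj_conj]
    ring

/-! ### The structure of additive bijections -/

/-- The image of `y ⊗ e` under the linear extension. -/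
theorem exists_map_rankOne {ψ : PosCone H → PosCone H} (h : IsConeIso ψ)
    {G : (H →L[ℂ] H) →ₗ[ℂ] (H →L[ℂ] H)} (hG : ∀ A : PosCone H, G A.1 = (ψ A).1)
    (hGs : ∀ X, G (star X) = star (G X)) {e u : H} (he : e ≠ 0) (hu : ψ (dyad e) = dyad u) (y : H) :
    ∃ w, ψ (dyad y) = dyad w ∧
      (G (rankOne ℂ y e) = rankOne ℂ w u ∨ G (rankOne ℂ y e) = rankOne ℂ u w) := by
  by_cases hy : ∃ c : ℂ, y = c • e
  · obtain ⟨c, rfl⟩ := hy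
    have hGd : G (rankOne ℂ e e) = rankOne ℂ u u := by
      have := hG (dyad e)
      rwa [hu] at this
    refine ⟨c • u, Subtype.ext ?_, Or.inl ?_⟩
    · rw [← hG, dyad_smul, dyad_smul, ← Complex.coe_smul, map_smul, hG, hu, Complex.coe_smul]
    · simp only [map_smul, smul_apply, hGd]
  push Not at hy
  obtain ⟨v, hv⟩ := h.exists_map_dyad y
  have hey : ∀ c : ℂ, e ≠ c • y := fun c hc => by
    have hc0 : c ≠ 0 := by rintro rfl; exact he (by rw [hc, zero_smul])
    exact hy c⁻¹ (by rw [hc, smul_smul, inv_mul_cancel₀ hc0, one_smul])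
  -- Independence is preserved, since `ψ` respects multiples of dyads.
  have indep : ∀ {x x' g g' : H}, ψ (dyad x) = dyad g → ψ (dyad x') = dyad g' →
      (∀ c : ℂ, x ≠ c • x') → ∀ c : ℂ, g ≠ c • g' := by
    rintro x x' g g' hg hg' hx c rfl
    have h1 : dyad (c • g') = scale (‖c‖₊ ^ 2) (dyad g') := Subtype.ext (by
      rw [dyad_smul]; simp [scale])
    rw [h1, ← hg', ← h.map_scale] at hg
    have h2 := h.injective hg
    rw [scale_dyad] at h2
    obtain ⟨d, -, hd⟩ := dyad_eq_dyad_iff.mp h2.symm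
    exact hx _ (by rw [hd, smul_smul])
  obtain ⟨w, hw, hw'⟩ := exists_of_pencil (X := G (rankOne ℂ y e)) (indep hu hv hey)
    (indep hv hu hy) fun t => by
      obtain ⟨g, hg⟩ := h.exists_map_dyad (e + t • y)
      refine ⟨g, ?_⟩
      rw [← hg, ← hu, ← hv, ← hG, ← hG, ← hG, ← hGs, ← map_smul G, ← map_smul G, ← map_smul G,
        ← map_add G, ← map_add G, ← map_add G]
      congr 1
      change rankOne ℂ e e + t • rankOne ℂ y e + conj t • star (rankOne ℂ y e) +
        (t * conj t) • rankOne ℂ y y = rankOne ℂ (e + t • y) (e + t • y)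
      rw [ContinuousLinearMap.star_eq_adjoint, InnerProductSpace.adjoint_rankOne]
      simp only [map_add, map_smul, add_apply, smul_apply, map_smulₛₗ, smul_add, smul_smul]
      rw [mul_comm t]
      abel
  exact ⟨w, by rw [hv, hw], hw'⟩

/-! ### Congruences -/

theorem nonneg_of_inner_eq {A B : H →L[ℂ] H} {s : H → H} (hA : 0 ≤ A)
    (h : ∀ z, inner ℂ (B z) z = inner ℂ (A (s z)) (s z)) : 0 ≤ B := by
  rw [ContinuousLinearMap.nonneg_iff_isPositive, ContinuousLinearMap.isPositive_iff_complex]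
  intro z
  rw [h, quad_eq_inner hA]
  exact ⟨rfl, quad_nonneg hA _⟩

theorem inner_linear_congruence (T A : H →L[ℂ] H) (z : H) :
    inner ℂ (T.comp (A.comp (adjoint T)) z) z = inner ℂ (A (adjoint T z)) (adjoint T z) :=
  (ContinuousLinearMap.adjoint_inner_right T _ _).symm

theorem inner_conj_congruence (T : H →L⋆[ℂ] H) {A : H →L[ℂ] H} (hA : 0 ≤ A) (z : H) :
    inner ℂ ((T.comp (A.comp (conjAdjoint T)) : H →L[ℂ] H) z) z =
      inner ℂ (A (conjAdjoint T z)) (conjAdjoint T z) := by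
  rw [inner_apply_comm hA]
  exact (conjAdjoint_inner T _ _).symm

/-- The congruence `A ↦ T A T*` by a bounded linear operator. -/
noncomputable def linearCongruence (T : H →L[ℂ] H) (A : PosCone H) : PosCone H :=
  ⟨T.comp (A.1.comp (adjoint T)), nonneg_of_inner_eq A.2 (inner_linear_congruence T A.1)⟩

/-- The congruence `A ↦ T A T*` by a bounded conjugate-linear operator. -/
noncomputable def conjCongruence (T : H →L⋆[ℂ] H) (A : PosCone H) : PosCone H :=
  ⟨T.comp (A.1.comp (conjAdjoint T)), nonneg_of_inner_eq A.2 (inner_conj_congruence T A.2)⟩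

theorem quad_linearCongruence (T : H →L[ℂ] H) (A : PosCone H) (z : H) :
    quad (linearCongruence T A).1 z = quad A.1 (adjoint T z) :=
  congrArg Complex.re (inner_linear_congruence T A.1 z)

theorem quad_conjCongruence (T : H →L⋆[ℂ] H) (A : PosCone H) (z : H) :
    quad (conjCongruence T A).1 z = quad A.1 (conjAdjoint T z) :=
  congrArg Complex.re (inner_conj_congruence T A.2 z)

theorem adjoint_adjoint_symm (T : H ≃L[ℂ] H) (z : H) :
    adjoint (T : H →L[ℂ] H) (adjoint (T.symm : H →L[ℂ] H) z) = z :=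
  ext_inner_right ℂ fun x => by
    rw [ContinuousLinearMap.adjoint_inner_left, ContinuousLinearMap.adjoint_inner_left]
    simp

theorem conjAdjoint_conjAdjoint_symm (T : H ≃SL[starRingEnd ℂ] H) (z : H) :
    conjAdjoint (T : H →L⋆[ℂ] H) (conjAdjoint (T.symm : H →L⋆[ℂ] H) z) = z :=
  ext_inner_right ℂ fun x => by
    rw [conjAdjoint_inner, ← inner_conj_symm, conjAdjoint_inner, inner_conj_symm]
    simp

theorem conjAdjoint_conjAdjoint (T : H →L⋆[ℂ] H) : conjAdjoint (conjAdjoint T) = T :=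
  ContinuousLinearMap.ext fun z => ext_inner_right ℂ fun x => by
    rw [conjAdjoint_inner, conjAdjoint_inner]

/-- The map is a congruence `A ↦ T A T*` by an invertible bounded linear or conjugate-linear
operator `T`. -/
def IsCongruence (ψ : PosCone H → PosCone H) : Prop :=
  (∃ T : H ≃L[ℂ] H, ψ = linearCongruence (T : H →L[ℂ] H)) ∨
    ∃ T : H ≃SL[starRingEnd ℂ] H, ψ = conjCongruence (T : H →L⋆[ℂ] H)

/-- The quadratic forms of a congruence are transported by an additive surjection, the adjoint. -/
theorem IsCongruence.exists_quad_eq {ψ : PosCone H → PosCone H} (h : IsCongruence ψ) :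
    ∃ s : H → H, (∀ a b, s (a - b) = s a - s b) ∧ Function.Surjective s ∧
      ∀ A z, quad (ψ A).1 z = quad A.1 (s z) := by
  rcases h with ⟨T, rfl⟩ | ⟨T, rfl⟩
  · exact ⟨adjoint (T : H →L[ℂ] H), map_sub _, fun z => ⟨_, adjoint_adjoint_symm T z⟩,
      quad_linearCongruence _⟩
  · exact ⟨conjAdjoint (T : H →L⋆[ℂ] H), map_sub _, fun z => ⟨_, conjAdjoint_conjAdjoint_symm T z⟩,
      quad_conjCongruence _⟩

theorem IsConeIso.eq_linearCongruence {ψ : PosCone H → PosCone H} (h : IsConeIso ψ) (T : H ≃L[ℂ] H)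
    (hT : ∀ x, ψ (dyad x) = dyad (T x)) : ψ = linearCongruence (T : H →L[ℂ] H) :=
  funext <| h.eq_congruence hT
    (fun x z => congrArg norm (ContinuousLinearMap.adjoint_inner_right (T : H →L[ℂ] H) x z).symm)
    (fun z => ⟨_, adjoint_adjoint_symm T z⟩) (quad_linearCongruence _)

theorem IsConeIso.eq_conjCongruence {ψ : PosCone H → PosCone H} (h : IsConeIso ψ)
    (T : H ≃SL[starRingEnd ℂ] H) (hT : ∀ x, ψ (dyad x) = dyad (T x)) :
    ψ = conjCongruence (T : H →L⋆[ℂ] H) :=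
  funext <| h.eq_congruence hT
    (fun x z => by
      rw [norm_inner_symm x]
      exact congrArg norm (conjAdjoint_inner (T : H →L⋆[ℂ] H) x z).symm)
    (fun z => ⟨_, conjAdjoint_conjAdjoint_symm T z⟩) (quad_conjCongruence _)

theorem submodule_eq_top_or_eq_top {R M : Type*} [Ring R] [AddCommGroup M] [Module R M]
    {V W : Submodule R M} (h : ∀ x, x ∈ V ∨ x ∈ W) : V = ⊤ ∨ W = ⊤ := by
  by_contra! hne
  obtain ⟨a, ha⟩ := show ∃ a, a ∉ V by simpa [Submodule.eq_top_iff'] using hne.1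
  obtain ⟨b, hb⟩ := show ∃ b, b ∉ W by simpa [Submodule.eq_top_iff'] using hne.2
  have ha' := (h a).resolve_left ha
  have hb' := (h b).resolve_right hb
  rcases h (a + b) with hab | hab
  · exact ha ((Submodule.add_mem_iff_left V hb').mp hab)
  · exact hb ((Submodule.add_mem_iff_right W ha').mp hab)

theorem dyad_eq_of_rankOne_eq {u w w' : H} (hu : u ≠ 0) (h : rankOne ℂ u w = rankOne ℂ w' u) :
    dyad w = dyad w' := by
  have h' : rankOne ℂ w u = rankOne ℂ u w' := InnerProductSpace.rankOne_eq_rankOne_iff_comm.mp h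
  have e1 := congrArg (fun A : H →L[ℂ] H => A u) h
  have e2 := congrArg (fun A : H →L[ℂ] H => A u) h'
  simp only [InnerProductSpace.rankOne_apply] at e1 e2
  have huu : inner ℂ u u ≠ 0 := inner_self_ne_zero.mpr hu
  have hw' : w' = ((inner ℂ u u)⁻¹ * inner ℂ w u) • u := by
    rw [mul_smul, e1, smul_smul, inv_mul_cancel₀ huu, one_smul]
  have hw : w = ((inner ℂ u u)⁻¹ * inner ℂ w' u) • u := by
    rw [mul_smul, ← e2, smul_smul, inv_mul_cancel₀ huu, one_smul]
  refine Subtype.ext ?_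
  have hn : ‖inner ℂ w u‖ = ‖inner ℂ w' u‖ := by
    have := congrArg (fun A : H →L[ℂ] H => inner ℂ u (A u)) h
    simp only [InnerProductSpace.rankOne_apply, inner_smul_right] at this
    rw [mul_comm] at this
    rw [mul_left_cancel₀ huu this, norm_inner_symm]
  have d1 : (dyad w).1 = ‖(inner ℂ u u)⁻¹ * inner ℂ w' u‖ ^ 2 • (dyad u).1 := by
    conv_lhs => rw [hw, dyad_smul]
  have d2 : (dyad w').1 = ‖(inner ℂ u u)⁻¹ * inner ℂ w u‖ ^ 2 • (dyad u).1 := by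
    conv_lhs => rw [hw', dyad_smul]
  rw [d1, d2, norm_mul, norm_mul, hn]

/-- Every additive bijection of `B(H)⁺` is a congruence. -/
theorem isCongruence_of_additive {ψ : PosCone H → PosCone H} (hψ : Function.Bijective ψ)
    (hadd : ∀ A B, ψ (A + B) = ψ A + ψ B) : IsCongruence ψ := by
  have h := isConeIso_of_additive hψ hadd
  rcases subsingleton_or_nontrivial H with hH | hH
  · exact Or.inl ⟨.refl ℂ H, h.eq_linearCongruence _ fun x => by
      rw [Subsingleton.elim x 0, dyad_zero, h.map_zero]; simp [dyad_zero]⟩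
  obtain ⟨G, hG, hGs⟩ := exists_linear_extension h hadd
  obtain ⟨e, he⟩ := exists_ne (0 : H)
  obtain ⟨u, hu⟩ := h.exists_map_dyad e
  have hu0 : u ≠ 0 := by
    rintro rfl
    rw [dyad_zero, ← h.map_zero] at hu
    exact he (dyad_eq_zero.mp (h.injective hu))
  have huu : inner ℂ u u ≠ 0 := inner_self_ne_zero.mpr hu0
  -- `D y = G (y ⊗ e)` is linear in `y` and its values lie in `H ⊗ u` or in `u ⊗ H`. A vector space
  -- is not the union of two proper subspaces, so one of the two alternatives holds throughout.
  set D : H →ₗ[ℂ] (H →L[ℂ] H) := G ∘ₗ ((rankOne ℂ : H →L[ℂ] H →L⋆[ℂ] H →L[ℂ] H).flip e) with hD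
  have hDw := exists_map_rankOne h hG hGs he hu
  have hDapp : ∀ y, D y = G (rankOne ℂ y e) := fun y => rfl
  set V := (LinearMap.range
    (((rankOne ℂ : H →L[ℂ] H →L⋆[ℂ] H →L[ℂ] H).flip u : H →L[ℂ] H →L[ℂ] H) :
      H →ₗ[ℂ] H →L[ℂ] H)).comap D with hV
  set W := (LinearMap.range
    ((rankOne ℂ u : H →L⋆[ℂ] H →L[ℂ] H) : H →ₗ⋆[ℂ] H →L[ℂ] H)).comap D with hW
  have hVW : ∀ y, y ∈ V ∨ y ∈ W := fun y => by
    obtain ⟨w, -, hw | hw⟩ := hDw y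
    · exact Or.inl ⟨w, hw.symm⟩
    · exact Or.inr ⟨w, hw.symm⟩
  rcases submodule_eq_top_or_eq_top hVW with htop | htop
  · left
    -- Evaluation at `u` recovers `w` from `w ⊗ u`.
    set T : H →ₗ[ℂ] H := (inner ℂ u u)⁻¹ •
      ((ContinuousLinearMap.apply ℂ H u : (H →L[ℂ] H) →L[ℂ] H) : (H →L[ℂ] H) →ₗ[ℂ] H) ∘ₗ D with hT
    have hTapp : ∀ y, T y = (inner ℂ u u)⁻¹ • D y u := fun y => rfl
    have hTd : ∀ y, ψ (dyad y) = dyad (T y) := fun y => by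
      obtain ⟨w, hw⟩ : y ∈ V := htop ▸ Submodule.mem_top
      have hw : rankOne ℂ w u = D y := hw
      have hTw : T y = w := by
        rw [hTapp, ← hw, InnerProductSpace.rankOne_apply, smul_smul, inv_mul_cancel₀ huu, one_smul]
      obtain ⟨w', hw', h1 | h1⟩ := hDw y
      · rw [hw', hTapp, hDapp, h1, InnerProductSpace.rankOne_apply, smul_smul,
          inv_mul_cancel₀ huu, one_smul]
      · rw [hw', hTw]
        exact dyad_eq_of_rankOne_eq hu0 (by rw [hw, hDapp, h1])
    obtain ⟨T', hT'⟩ := h.exists_continuousLinearEquiv T hTd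
    exact ⟨T', h.eq_linearCongruence T' fun x => by rw [hTd, hT']⟩
  · right
    set T : H →ₗ⋆[ℂ] H :=
      { toFun := fun y => (inner ℂ u u)⁻¹ • star (D y) u
        map_add' := fun a b => by rw [map_add, star_add, add_apply, smul_add]
        map_smul' := fun c a => by
          rw [map_smul, star_smul, smul_apply, smul_comm]; rfl } with hT
    have hTapp : ∀ y w, D y = rankOne ℂ u w → T y = w := fun y w hw => by
      change (inner ℂ u u)⁻¹ • star (D y) u = w
      rw [hw, ContinuousLinearMap.star_eq_adjoint, InnerProductSpace.adjoint_rankOne,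
        InnerProductSpace.rankOne_apply, smul_smul, inv_mul_cancel₀ huu, one_smul]
    have hTd : ∀ y, ψ (dyad y) = dyad (T y) := fun y => by
      obtain ⟨w, hw⟩ : y ∈ W := htop ▸ Submodule.mem_top
      have hw : rankOne ℂ u w = D y := hw
      obtain ⟨w', hw', h1 | h1⟩ := hDw y
      · rw [hw', hTapp y w hw.symm]
        exact (dyad_eq_of_rankOne_eq hu0 (by rw [hw, hDapp, h1])).symm
      · rw [hw', hTapp y w' h1]
    obtain ⟨T', hT'⟩ := h.exists_continuousLinearEquiv T hTd
    exact ⟨T', h.eq_conjCongruence T' fun x => by rw [hTd, hT']⟩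

theorem quad_arithmeticMean (A B : PosCone H) (z : H) :
    quad (arithmeticMean A B).1 z = 2⁻¹ * (quad A.1 z + quad B.1 z) := by
  rw [arithmeticMean, quad_smul, quad_add]

/-- A bijection preserving the arithmetic mean fixes `0`, because `Z` is the mean of `2 Z` and `0`;
hence it is additive. -/
theorem isCongruence_of_arithmeticMean {ψ : PosCone H → PosCone H} (hψ : Function.Bijective ψ)
    (hmean : ∀ A B, ψ (arithmeticMean A B) = arithmeticMean (ψ A) (ψ B)) : IsCongruence ψ := by
  have hq0 : ∀ z : H, quad (0 : PosCone H).1 z = 0 := fun z => by simp [quad]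
  have hhalf : ∀ A : PosCone H, arithmeticMean (scale 2 A) 0 = A := fun A =>
    PosCone.ext_quad fun z => by
      rw [quad_arithmeticMean, quad_scale, hq0, NNReal.coe_ofNat]; ring
  have h0 : ψ 0 = 0 := by
    obtain ⟨Z, hZ⟩ := hψ.2 0
    refine PosCone.ext_quad fun z => ?_
    have h1 := congrArg (fun A : PosCone H => quad A.1 z) (hmean (scale 2 Z) 0)
    simp only [hhalf, hZ, quad_arithmeticMean] at h1
    have := quad_nonneg (ψ 0).2 z
    have := quad_nonneg (ψ (scale 2 Z)).2 z
    rw [hq0] at h1 ⊢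
    linarith
  have hdouble : ∀ (A : PosCone H) z, quad (ψ A).1 z = 2⁻¹ * quad (ψ (scale 2 A)).1 z :=
    fun A z => by
      have h1 := congrArg (fun A : PosCone H => quad A.1 z) (hmean (scale 2 A) 0)
      simp only [hhalf, h0, quad_arithmeticMean, hq0, add_zero] at h1
      exact h1
  refine isCongruence_of_additive hψ fun A B => PosCone.ext_quad fun z => ?_
  have e : A + B = arithmeticMean (scale 2 A) (scale 2 B) := PosCone.ext_quad fun z => by
    rw [quad_arithmeticMean, quad_scale, quad_scale, NNReal.coe_ofNat]
    refine (quad_add A.1 B.1 z).trans ?_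
    ring
  rw [e, hmean, quad_arithmeticMean]
  refine Eq.trans ?_ (quad_add (ψ A).1 (ψ B).1 z).symm
  rw [hdouble A, hdouble B]
  ring

/-! ### Rank-one operators and the harmonic mean -/

theorem dyad_le_scale_dyad_iff {x : H} (hx : x ≠ 0) {c : ℝ≥0} :
    dyad x ≤ scale c (dyad x) ↔ 1 ≤ c := by
  refine ⟨fun h => ?_, fun h => by simpa [scale_one] using scale_mono h (dyad x)⟩
  have h1 := PosCone.le_iff.mp h x
  rw [quad_scale, quad_dyad] at h1
  have h2 : 0 < ‖inner ℂ x x‖ ^ 2 := by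
    have : inner ℂ x x ≠ 0 := inner_self_ne_zero.mpr hx
    positivity
  have h3 : (1 : ℝ) ≤ c := le_of_mul_le_mul_right (by linarith) h2
  exact_mod_cast h3

theorem scale_eq_zero {c : ℝ≥0} {A : PosCone H} (h : scale c A = 0) : c = 0 ∨ A = 0 := by
  by_cases hc : c = 0
  · exact Or.inl hc
  · right
    rw [← scale_one A, ← inv_mul_cancel₀ hc, ← scale_scale, h, scale_zero_right]

theorem exists_harmonicMean_dyad (x : H) (B : PosCone H) :
    ∃ c, harmonicMean (dyad x) B = scale c (dyad x) := by
  have h := harmonicMean_le_left (dyad x) B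
  rw [scale_dyad] at h
  obtain ⟨c, hc⟩ := exists_scale_of_le_dyad h
  rw [← scale_dyad, scale_scale] at hc
  exact ⟨_, hc⟩

theorem harmonicMean_dyad_ne_zero_iff {x : H} (hx : x ≠ 0) {B : PosCone H} :
    harmonicMean (dyad x) B ≠ 0 ↔ ∃ c, c ≠ 0 ∧ scale c (dyad x) ≤ B := by
  have hd : dyad x ≠ 0 := fun h => hx (dyad_eq_zero.mp h)
  constructor
  · intro h
    obtain ⟨c, hc⟩ := exists_harmonicMean_dyad x B
    have hc0 : c ≠ 0 := by
      rintro rfl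
      exact h (by rw [hc, scale_zero_left])
    refine ⟨2⁻¹ * c, mul_ne_zero (by norm_num) hc0, ?_⟩
    rw [← scale_scale, ← hc, scale_le_iff (by norm_num), inv_inv]
    exact harmonicMean_le_right _ _
  · rintro ⟨c, hc, hcB⟩ h
    have h1 : scale (min c 1) (dyad x) ≤ dyad x := by
      simpa [scale_one] using scale_mono (min_le_right c 1) (dyad x)
    have h2 := harmonicMean_mono h1 ((scale_mono (min_le_left c 1) _).trans hcB)
    rw [harmonicMean_self, h] at h2
    rcases scale_eq_zero (le_antisymm h2 (scale (min c 1) (dyad x)).2) with h3 | h3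
    · exact (lt_min (pos_iff_ne_zero.mpr hc) one_pos).ne' h3
    · exact hd h3

theorem harmonicMean_ne_zero_of_le {A B C : PosCone H} (hC : C ≠ 0) (hA : C ≤ A) (hB : C ≤ B) :
    harmonicMean A B ≠ 0 := fun h => by
  have := harmonicMean_mono hA hB
  rw [harmonicMean_self, h] at this
  exact hC (le_antisymm this C.2)

theorem harmonicMean_dyad_dyad_ne_zero {x y : H} (hx : x ≠ 0)
    (h : harmonicMean (dyad x) (dyad y) ≠ 0) : ∃ c, c ≠ 0 ∧ dyad y = scale c (dyad x) := by
  obtain ⟨c, hc, hle⟩ := (harmonicMean_dyad_ne_zero_iff hx).mp h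
  obtain ⟨d, hd⟩ := exists_scale_of_le_dyad hle
  have hd0 : d ≠ 0 := by
    rintro rfl
    rw [scale_zero_left] at hd
    rcases scale_eq_zero hd with h1 | h1
    · exact hc h1
    · exact hx (dyad_eq_zero.mp h1)
  refine ⟨d⁻¹ * c, mul_ne_zero (inv_ne_zero hd0) hc, ?_⟩
  rw [← scale_scale, hd, scale_scale, inv_mul_cancel₀ hd0, scale_one]

/-- Rank one in terms of the harmonic mean: the operators of rank one are the nonzero `A` for
which the annihilator `{B | A ! B = 0}` is maximal. -/
theorem isDyad_iff_maximal_annihilator {A : PosCone H} :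
    (∃ x : H, x ≠ 0 ∧ A = dyad x) ↔ A ≠ 0 ∧ ∀ A' : PosCone H, A' ≠ 0 →
      (∀ B, harmonicMean A B = 0 → harmonicMean A' B = 0) →
      ∀ B, harmonicMean A' B = 0 → harmonicMean A B = 0 := by
  constructor
  · rintro ⟨x, hx, rfl⟩
    refine ⟨fun h => hx (dyad_eq_zero.mp h), fun A' hA' hsub B hB => ?_⟩
    by_contra hne
    have h1 : harmonicMean (dyad x) A' ≠ 0 := fun h => by
      have := hsub _ h
      rw [harmonicMean_self] at this
      exact hA' this
    obtain ⟨c, hc, hcA⟩ := (harmonicMean_dyad_ne_zero_iff hx).mp h1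
    obtain ⟨d, hd, hdB⟩ := (harmonicMean_dyad_ne_zero_iff hx).mp hne
    refine harmonicMean_ne_zero_of_le (C := scale (min c d) (dyad x)) (fun h => ?_)
      ((scale_mono (min_le_left c d) _).trans hcA) ((scale_mono (min_le_right c d) _).trans hdB) hB
    rcases scale_eq_zero h with h3 | h3
    · exact (lt_min (pos_iff_ne_zero.mpr hc) (pos_iff_ne_zero.mpr hd)).ne' h3
    · exact hx (dyad_eq_zero.mp h3)
  · rintro ⟨hA, hmax⟩
    obtain ⟨x, hx, hxA⟩ := exists_dyad_le hA
    have hsub := hmax (dyad x) (fun h => hx (dyad_eq_zero.mp h)) fun B hB =>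
      le_antisymm ((harmonicMean_mono hxA le_rfl).trans_eq hB) (harmonicMean _ B).2
    -- Every vector `A z` is a multiple of `x`, so `A` vanishes on the complement of `x`.
    have hpar : ∀ z, A.1 z ≠ 0 → ∃ c : ℂ, A.1 z = c • x := fun z hz => by
      have hdz : dyad (A.1 z) ≠ 0 := fun h => hz (dyad_eq_zero.mp h)
      have hle := dyad_apply_le A z
      have hq : (quad A.1 z).toNNReal ≠ 0 := fun h0 => by
        rw [h0, scale_zero_left] at hle
        exact hdz (le_antisymm hle (dyad _).2)
      have h1 : harmonicMean (dyad (A.1 z)) A ≠ 0 :=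
        (harmonicMean_dyad_ne_zero_iff hz).mpr ⟨(quad A.1 z).toNNReal⁻¹, inv_ne_zero hq, by
          rwa [scale_le_iff (inv_ne_zero hq), inv_inv]⟩
      have h2 : harmonicMean A (dyad (A.1 z)) ≠ 0 := by
        obtain ⟨c, hc, hcA⟩ := (harmonicMean_dyad_ne_zero_iff hz).mp h1
        refine harmonicMean_ne_zero_of_le (C := scale (min c 1) (dyad (A.1 z))) (fun h => ?_)
          ((scale_mono (min_le_left c 1) _).trans hcA)
          ((scale_mono (min_le_right c 1) _).trans_eq (scale_one _))
        rcases scale_eq_zero h with h3 | h3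
        · exact (lt_min (pos_iff_ne_zero.mpr hc) one_pos).ne' h3
        · exact hdz h3
      obtain ⟨c, -, hc⟩ := harmonicMean_dyad_dyad_ne_zero hx fun h => h2 (hsub _ h)
      rw [scale_dyad] at hc
      obtain ⟨d, -, hd⟩ := dyad_eq_dyad_iff.mp hc.symm
      exact ⟨_, by rw [hd, smul_smul]⟩
    obtain ⟨c, hc⟩ := exists_scale_of_ker (C := A) hx fun z hz => by
      by_contra hne
      obtain ⟨c, hc⟩ := hpar z hne
      refine hne (apply_eq_zero_of_quad A.2 ?_)
      rw [quad, hc, inner_smul_left, hz, mul_zero, Complex.zero_re]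
    rw [scale_dyad] at hc
    exact ⟨_, fun h => hA (by rw [hc, h, dyad_zero]), hc⟩

/-! ### Bijections preserving the harmonic mean -/

/-- A bijection of `[0, ∞)` fixing `0` and preserving midpoints of positive numbers is linear. -/
theorem midpoint_bijection_eq_mul {h : ℝ≥0 → ℝ≥0} (hb : Function.Bijective h) (h0 : h 0 = 0)
    (hmid : ∀ a b, a ≠ 0 → b ≠ 0 → h ((a + b) / 2) = (h a + h b) / 2) (t : ℝ≥0) :
    h t = t * h 1 := by
  have hne : ∀ a, h a ≠ 0 ↔ a ≠ 0 := fun a => not_congr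
    ⟨fun ha => hb.1 (ha.trans h0.symm), fun ha => by rw [ha, h0]⟩
  have hpos : ∀ a, a ≠ 0 → 0 < h a := fun a ha => pos_iff_ne_zero.mpr ((hne a).mpr ha)
  -- The midpoints of `t` with positive numbers are the numbers greater than `t / 2`.
  have hlt : ∀ t r, t ≠ 0 → (h t < 2 * h r ↔ t < 2 * r) := fun t r ht => by
    constructor
    · intro hr
      obtain ⟨s, hs⟩ := hb.2 (2 * h r - h t)
      have hs0 : s ≠ 0 := (hne s).mp (by rw [hs]; exact (tsub_pos_of_lt hr).ne')
      have h1 := hmid t s ht hs0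
      rw [hs, add_tsub_cancel_of_le hr.le, mul_div_cancel_left₀ _ two_ne_zero] at h1
      rw [← hb.1 h1, mul_div_cancel₀ _ two_ne_zero]
      exact lt_add_of_pos_right t (pos_iff_ne_zero.mpr hs0)
    · intro hr
      have hs0 : 2 * r - t ≠ 0 := (tsub_pos_of_lt hr).ne'
      have h1 := hmid t (2 * r - t) ht hs0
      rw [add_tsub_cancel_of_le hr.le, mul_div_cancel_left₀ _ two_ne_zero] at h1
      rw [h1, mul_div_cancel₀ _ two_ne_zero]
      exact lt_add_of_pos_right _ (hpos _ hs0)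
  have hle : ∀ r, 2 * h r ≤ h (2 * r) := fun r => by
    by_cases hr : r = 0
    · rw [hr, mul_zero, h0, mul_zero]
    · exact not_lt.mp fun hc => lt_irrefl _ ((hlt (2 * r) r (mul_ne_zero two_ne_zero hr)).mp hc)
  have hdouble : ∀ r, h (2 * r) = 2 * h r := fun r => by
    refine le_antisymm (not_lt.mp fun hc => ?_) (hle r)
    have hr : r ≠ 0 := by
      rintro rfl
      rw [mul_zero, h0, mul_zero] at hc
      exact lt_irrefl _ hc
    obtain ⟨s, hs⟩ := hb.2 (h (2 * r) / 2)
    have h2s : 2 * h s = h (2 * r) := by rw [hs, mul_div_cancel₀ _ two_ne_zero]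
    have h1 : ¬ 2 * r < 2 * s := fun hlt' =>
      h2s.not_gt ((hlt (2 * r) s (mul_ne_zero two_ne_zero hr)).mpr hlt')
    have h2 : s ≠ r := by
      rintro rfl
      exact hc.ne h2s
    have h3 : s < r := lt_of_le_of_ne
      (le_of_mul_le_mul_left (not_lt.mp h1) two_pos) h2
    have hs0 : s ≠ 0 := by
      rintro rfl
      rw [h0, mul_zero] at h2s
      exact (hne _).mpr (mul_ne_zero two_ne_zero hr) h2s.symm
    have h4 := (hlt (2 * s) r (mul_ne_zero two_ne_zero hs0)).mpr
      (mul_lt_mul_of_pos_left h3 two_pos)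
    exact absurd ((hle s).trans_lt h4) (by rw [h2s]; exact hc.not_gt)
  have hadd : ∀ a b, h (a + b) = h a + h b := fun a b => by
    by_cases ha : a = 0
    · rw [ha, h0, zero_add, zero_add]
    by_cases hb' : b = 0
    · rw [hb', h0, add_zero, add_zero]
    have h1 := hdouble ((a + b) / 2)
    rwa [hmid a b ha hb', mul_div_cancel₀ _ two_ne_zero, mul_div_cancel₀ _ two_ne_zero] at h1
  have := additive_eq_mul (h := fun t => (h t : ℝ)) (fun t => (h t).2)
    (fun a b => by rw [hadd]; push_cast; rfl) t
  exact_mod_cast this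

/-- The bijection `ψ` of the cone satisfies `ψ (A ! B) = ψ A ! ψ B`. -/
def PreservesHarmonicMean (ψ : PosCone H ≃ PosCone H) : Prop :=
  ∀ A B, ψ (harmonicMean A B) = harmonicMean (ψ A) (ψ B)

namespace PreservesHarmonicMean

variable {ψ : PosCone H ≃ PosCone H}

theorem symm (h : PreservesHarmonicMean ψ) : PreservesHarmonicMean ψ.symm := fun A B =>
  ψ.injective (by rw [h, ψ.apply_symm_apply, ψ.apply_symm_apply, ψ.apply_symm_apply])

theorem map_zero (h : PreservesHarmonicMean ψ) : ψ 0 = 0 := by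
  have := h 0 (ψ.symm 0)
  rwa [zero_harmonicMean, ψ.apply_symm_apply, harmonicMean_zero] at this

theorem map_eq_zero (h : PreservesHarmonicMean ψ) {A : PosCone H} : ψ A = 0 ↔ A = 0 := by
  rw [← h.map_zero, ψ.apply_eq_iff_eq, h.map_zero]

theorem exists_map_dyad (h : PreservesHarmonicMean ψ) {x : H} (hx : x ≠ 0) :
    ∃ y : H, y ≠ 0 ∧ ψ (dyad x) = dyad y := by
  obtain ⟨h0, hmax⟩ := isDyad_iff_maximal_annihilator.mp ⟨x, hx, rfl⟩
  refine isDyad_iff_maximal_annihilator.mpr ⟨fun h1 => h0 (h.map_eq_zero.mp h1), ?_⟩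
  rw [ψ.surjective.forall]
  intro A' hA' hsub
  rw [ψ.surjective.forall] at hsub ⊢
  simp only [← h _ _, h.map_eq_zero] at hsub ⊢
  exact hmax A' (fun h1 => hA' (h.map_eq_zero.mpr h1)) hsub

theorem exists_map_scale_dyad (h : PreservesHarmonicMean ψ) {x y : H} (hx : x ≠ 0)
    (hy : ψ (dyad x) = dyad y) (c : ℝ≥0) : ∃ d, ψ (scale c (dyad x)) = scale d (dyad y) := by
  by_cases hc : c = 0
  · exact ⟨0, by rw [hc, scale_zero_left, scale_zero_left, h.map_zero]⟩
  have hdx : dyad x ≠ 0 := fun h => hx (dyad_eq_zero.mp h)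
  have hcx : scale c (dyad x) ≠ 0 := fun h0 => (scale_eq_zero h0).elim hc hdx
  have hy0 : y ≠ 0 := by
    rintro rfl
    rw [dyad_zero, h.map_eq_zero] at hy
    exact hdx hy
  have hne : harmonicMean (dyad x) (scale c (dyad x)) ≠ 0 :=
    (harmonicMean_dyad_ne_zero_iff hx).mpr ⟨c, hc, le_rfl⟩
  rw [scale_dyad] at hne hcx ⊢
  obtain ⟨y', -, hy'⟩ := h.exists_map_dyad (fun h0 => hcx (dyad_eq_zero.mpr h0))
  have h1 := (not_congr h.map_eq_zero).mpr hne
  rw [h, hy, hy'] at h1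
  obtain ⟨d, -, hd⟩ := harmonicMean_dyad_dyad_ne_zero hy0 h1
  exact ⟨d, hy'.trans hd⟩

theorem scale_dyad_injective {x : H} (hx : x ≠ 0) {c d : ℝ≥0}
    (h : scale c (dyad x) = scale d (dyad x)) : c = d := by
  have h1 := congrArg (fun A : PosCone H => quad A.1 x) h
  simp only [quad_scale, quad_dyad] at h1
  have h2 : ‖inner ℂ x x‖ ^ 2 ≠ 0 := by simpa using hx
  exact_mod_cast mul_right_cancel₀ h2 h1

/-- Bijections preserving the harmonic mean are homogeneous on operators of rank one. With
`ψ (t R) = f t • ψ R`, the function `t ↦ 1 / f (1 / t)` preserves midpoints. -/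
theorem map_scale_dyad (h : PreservesHarmonicMean ψ) (c : ℝ≥0) (x : H) :
    ψ (scale c (dyad x)) = scale c (ψ (dyad x)) := by
  by_cases hx : x = 0
  · rw [hx, dyad_zero, scale_zero_right, h.map_zero, scale_zero_right]
  obtain ⟨y, hy, hxy⟩ := h.exists_map_dyad hx
  have hyx : ψ.symm (dyad y) = dyad x := by rw [← hxy, ψ.symm_apply_apply]
  choose f hf using h.exists_map_scale_dyad hx hxy
  choose g hg using h.symm.exists_map_scale_dyad hy hyx
  have hgf : ∀ c, g (f c) = c := fun c => scale_dyad_injective hx (by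
    rw [← hg, ← hf, ψ.symm_apply_apply])
  have hfg : ∀ c, f (g c) = c := fun c => scale_dyad_injective hy (by
    rw [← hf, ← hg, ψ.apply_symm_apply])
  have hf0 : f 0 = 0 := scale_dyad_injective hy (by
    rw [← hf, scale_zero_left, scale_zero_left, h.map_zero])
  have hf1 : f 1 = 1 := scale_dyad_injective hy (by rw [← hf, scale_one, scale_one, hxy])
  have hfne : ∀ t, t ≠ 0 → f t ≠ 0 := fun t ht h0 =>
    ht ((hgf t).symm.trans ((congrArg g (h0.trans hf0.symm)).trans (hgf 0)))
  have hharm : ∀ t s, t ≠ 0 → s ≠ 0 →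
      f (2 * t * s / (t + s)) = 2 * f t * f s / (f t + f s) := fun t s ht hs =>
    scale_dyad_injective hy (by
      rw [← hf, ← harmonicMean_scale_dyad ht hs, h, hf, hf,
        harmonicMean_scale_dyad (hfne t ht) (hfne s hs)])
  have hlin := midpoint_bijection_eq_mul (h := fun t => (f t⁻¹)⁻¹)
    ⟨fun a b hab => by
      have h1 := congrArg g (inv_injective hab)
      rw [hgf, hgf] at h1
      exact inv_injective h1,
    fun b => ⟨(g b⁻¹)⁻¹, by simp only [inv_inv, hfg]⟩⟩
    (by simp only [inv_zero, hf0]) (fun a b ha hb => by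
      have hab : a + b ≠ 0 := fun h0 => ha (add_eq_zero.mp h0).1
      have e : ((a + b) / 2)⁻¹ = 2 * a⁻¹ * b⁻¹ / (a⁻¹ + b⁻¹) := by
        field_simp
        rw [add_comm]
      have hfa := hfne _ (inv_ne_zero ha)
      have hfb := hfne _ (inv_ne_zero hb)
      rw [e, hharm _ _ (inv_ne_zero ha) (inv_ne_zero hb)]
      generalize f a⁻¹ = u at *
      generalize f b⁻¹ = v at *
      field_simp
      rw [add_comm])
  have hc : f c = c := by
    have h1 := hlin c⁻¹
    simp only [inv_inv, inv_one, hf1, mul_one] at h1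
    exact inv_injective h1
  rw [hf, hc, hxy]

theorem dyad_le_iff (h : PreservesHarmonicMean ψ) (x : H) (B : PosCone H) :
    ψ (dyad x) ≤ ψ B ↔ dyad x ≤ B := by
  by_cases hx : x = 0
  · rw [hx, dyad_zero, h.map_zero]
    exact iff_of_true (ψ B).2 B.2
  obtain ⟨y, hy, hxy⟩ := h.exists_map_dyad hx
  obtain ⟨c, hc⟩ := exists_harmonicMean_dyad x B
  rw [hxy, dyad_le_iff_harmonicMean x, dyad_le_iff_harmonicMean y, ← hxy, ← h, hc,
    h.map_scale_dyad, hxy, dyad_le_scale_dyad_iff hx, dyad_le_scale_dyad_iff hy]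

theorem exists_dyad_preimage (h : PreservesHarmonicMean ψ) (y : H) :
    ∃ x, ψ (dyad x) = dyad y := by
  by_cases hy : y = 0
  · exact ⟨0, by rw [hy, dyad_zero, h.map_zero]⟩
  · obtain ⟨x, -, hx⟩ := h.symm.exists_map_dyad hy
    exact ⟨x, by rw [← hx, ψ.apply_symm_apply]⟩

theorem isConeIso (h : PreservesHarmonicMean ψ) : IsConeIso ψ := by
  refine ⟨ψ.surjective, fun A B => ⟨fun hAB => le_iff_dyad.mpr fun x hx => ?_,
    fun hAB => le_iff_dyad.mpr fun y hy => ?_⟩, fun c B => ?_⟩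
  · exact (h.dyad_le_iff x B).mp (((h.dyad_le_iff x A).mpr hx).trans hAB)
  · obtain ⟨x, hx⟩ := h.exists_dyad_preimage y
    rw [← hx, h.dyad_le_iff] at hy ⊢
    exact hy.trans hAB
  by_cases hc : c = 0
  · rw [hc, scale_zero_left, scale_zero_left, h.map_zero]
  have key : ∀ y, dyad y ≤ ψ (scale c B) ↔ dyad y ≤ scale c (ψ B) := fun y => by
    obtain ⟨x, hx⟩ := h.exists_dyad_preimage y
    have hc' : c⁻¹ ≠ 0 := inv_ne_zero hc
    have h1 : ∀ A B : PosCone H, A ≤ scale c B ↔ scale c⁻¹ A ≤ B := fun A B => by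
      rw [scale_le_iff hc', inv_inv]
    rw [← hx, h.dyad_le_iff, h1, h1, ← h.map_scale_dyad, scale_dyad, h.dyad_le_iff]
  exact le_antisymm (le_iff_dyad.mpr fun y => (key y).mp) (le_iff_dyad.mpr fun y => (key y).mpr)

end PreservesHarmonicMean

/-! ### Inversion -/

theorem scale_one_strictlyPositive {c : ℝ≥0} (hc : c ≠ 0) :
    IsStrictlyPositive (scale c (1 : PosCone H)).1 := by
  have := shift_strictlyPositive (le_refl (0 : H →L[ℂ] H)) (ε := c) (by positivity)
  rwa [shift, zero_add, Algebra.algebraMap_eq_smul_one] at this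

theorem le_scale_norm (A : PosCone H) : A ≤ scale (‖A.1‖₊ + 1) 1 :=
  PosCone.le_iff.mpr fun z => by
    rw [quad_scale]
    refine (quad_le_norm A.1 z).trans ?_
    change _ ≤ _ * quad 1 z
    rw [quad_one]
    push_cast
    gcongr
    linarith

/-- The inverse of a positive invertible operator; it is `0` on noninvertible ones. -/
noncomputable def coneInv (A : PosCone H) : PosCone H :=
  ⟨Ring.inverse A.1, by
    by_cases hA : IsUnit A.1
    · exact (inverse_strictlyPositive ⟨A.2, hA⟩).nonneg
    · rw [Ring.inverse_non_unit _ hA]⟩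

theorem coneInv_strictlyPositive {A : PosCone H} (hA : IsStrictlyPositive A.1) :
    IsStrictlyPositive (coneInv A).1 := inverse_strictlyPositive hA

theorem coneInv_coneInv {A : PosCone H} (hA : IsStrictlyPositive A.1) : coneInv (coneInv A) = A := by
  refine Subtype.ext ?_
  obtain ⟨u, hu⟩ := hA.isUnit
  change Ring.inverse (Ring.inverse A.1) = A.1
  rw [← hu, Ring.inverse_unit, Ring.inverse_unit, inv_inv]

theorem coneInv_le {A B : PosCone H} (hA : IsStrictlyPositive A.1) (hB : IsStrictlyPositive B.1)
    (h : A ≤ B) : coneInv B ≤ coneInv A := inverse_anti hA hB h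

/-- The invertible elements of the cone are its order units. -/
theorem strictlyPositive_iff {A : PosCone H} :
    IsStrictlyPositive A.1 ↔ ∃ c, c ≠ 0 ∧ scale c 1 ≤ A := by
  constructor
  · intro hA
    have h1 := le_scale_norm (coneInv A)
    set k := ‖(coneInv A).1‖₊ + 1
    have hk : k ≠ 0 := by positivity
    have h2 := coneInv_le (coneInv_strictlyPositive hA) (scale_one_strictlyPositive hk) h1
    rw [coneInv_coneInv hA] at h2
    refine ⟨k⁻¹, inv_ne_zero hk, le_trans (le_of_eq (Subtype.ext ?_)) h2⟩
    have hk' : (k : ℝ) ≠ 0 := by exact_mod_cast hk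
    refine ((scale_one_strictlyPositive hk).isUnit.mul_left_cancel ?_ :
      (scale k⁻¹ (1 : PosCone H)).1 = Ring.inverse (scale k (1 : PosCone H)).1)
    rw [Ring.mul_inverse_cancel _ (scale_one_strictlyPositive hk).isUnit]
    change ((k : ℝ) • (1 : H →L[ℂ] H)) * (((k⁻¹ : ℝ≥0) : ℝ) • (1 : H →L[ℂ] H)) = 1
    rw [smul_mul_smul_comm, one_mul, NNReal.coe_inv, mul_inv_cancel₀ hk', one_smul]
  · rintro ⟨c, hc, hle⟩
    exact (scale_one_strictlyPositive hc).of_le hle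

theorem IsConeIso.strictlyPositive {ψ : PosCone H → PosCone H} (h : IsConeIso ψ) {A : PosCone H}
    (hA : IsStrictlyPositive A.1) : IsStrictlyPositive (ψ A).1 := by
  obtain ⟨c, hc, hcA⟩ := strictlyPositive_iff.mp hA
  obtain ⟨D, hD⟩ := h.surjective 1
  have h1 := (h.le_iff _ _).mpr (le_scale_norm D)
  have h2 := (h.le_iff _ _).mpr hcA
  set k := ‖D.1‖₊ + 1
  have hk : k ≠ 0 := by positivity
  rw [hD, h.map_scale] at h1
  rw [h.map_scale] at h2
  have h3 : scale k⁻¹ 1 ≤ ψ 1 := by rwa [scale_le_iff (inv_ne_zero hk), inv_inv]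
  refine strictlyPositive_iff.mpr ⟨c * k⁻¹, mul_ne_zero hc (inv_ne_zero hk), ?_⟩
  rw [← scale_scale]
  exact (scale_le_scale h3).trans h2

theorem harmonicMean_coneInv {A B : PosCone H} (hA : IsStrictlyPositive A.1)
    (hB : IsStrictlyPositive B.1) :
    harmonicMean (coneInv A) (coneInv B) = scale 2 (coneInv (A + B)) := by
  refine Subtype.ext ?_
  rw [harmonicMean_of_strictlyPositive (coneInv_strictlyPositive hA) (coneInv_strictlyPositive hB),
    invHarmonicMean]
  have h1 := congrArg Subtype.val (coneInv_coneInv hA)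
  have h2 := congrArg Subtype.val (coneInv_coneInv hB)
  change Ring.inverse (coneInv A).1 = A.1 at h1
  change Ring.inverse (coneInv B).1 = B.1 at h2
  rw [h1, h2]
  rfl

/-! ### The structure of bijections preserving the harmonic mean -/

theorem le_of_forall_pos_le_add_mul {a b k : ℝ} (h : ∀ ε : ℝ≥0, ε ≠ 0 → a ≤ b + ε * k) : a ≤ b := by
  have hlim : Tendsto (fun ε : ℝ => b + ε * k) (𝓝[>] 0) (𝓝 b) := by
    have : Continuous fun ε : ℝ => b + ε * k := by fun_prop
    simpa using (this.tendsto 0).mono_left nhdsWithin_le_nhds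
  refine ge_of_tendsto hlim ?_
  filter_upwards [self_mem_nhdsWithin] with ε hε
  have hε : 0 < ε := hε
  simpa [Real.coe_toNNReal _ hε.le] using h ε.toNNReal (by simpa using hε)

theorem add_strictlyPositive {A B : PosCone H} (hB : IsStrictlyPositive B.1) :
    IsStrictlyPositive (A + B).1 := hB.nonneg_add A.2

theorem one_strictlyPositive : IsStrictlyPositive (1 : PosCone H).1 := by
  rw [← scale_one (1 : PosCone H)]
  exact scale_one_strictlyPositive one_ne_zero

/-- An order automorphism agreeing with a congruence on invertible operators agrees with it
everywhere, because `A` is the infimum of the invertible operators `A + ε I`. -/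
theorem IsConeIso.eq_of_strictlyPositive {ψ K : PosCone H → PosCone H} (h : IsConeIso ψ)
    {s : H → H} (hK : ∀ A z, quad (K A).1 z = quad A.1 (s z))
    (hagree : ∀ A : PosCone H, IsStrictlyPositive A.1 → ψ A = K A)
    (hstrict : ∀ A : PosCone H, IsStrictlyPositive (ψ A).1 → IsStrictlyPositive A.1) : ψ = K := by
  have hadd : ∀ (A B : PosCone H) z, quad (A + B).1 z = quad A.1 z + quad B.1 z := fun A B z =>
    quad_add A.1 B.1 z
  funext B
  refine le_antisymm (PosCone.le_iff.mpr fun z => ?_) (PosCone.le_iff.mpr fun z => ?_)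
  · refine le_of_forall_pos_le_add_mul (k := ‖s z‖ ^ 2) fun ε hε => ?_
    have hle : B ≤ B + scale ε 1 := Subtype.coe_le_coe.mp (le_add_of_nonneg_right (scale ε 1).2)
    have h1 := PosCone.le_iff.mp ((h.le_iff _ _).mpr hle) z
    rw [hagree _ (add_strictlyPositive (scale_one_strictlyPositive hε)), hK, hadd, quad_scale] at h1
    change _ ≤ _ + _ * quad 1 _ at h1
    rwa [quad_one, ← hK] at h1
  · refine le_of_forall_pos_le_add_mul (k := ‖z‖ ^ 2) fun ε hε => ?_
    obtain ⟨C, hC⟩ := h.surjective (ψ B + scale ε 1)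
    have hCs : IsStrictlyPositive C.1 :=
      hstrict C (hC ▸ add_strictlyPositive (scale_one_strictlyPositive hε))
    have hle : ψ B ≤ ψ C :=
      hC ▸ Subtype.coe_le_coe.mp (le_add_of_nonneg_right (scale ε 1).2)
    have h1 := PosCone.le_iff.mp ((h.le_iff _ _).mp hle) (s z)
    rw [← hK, ← hK, ← hagree C hCs, hC, hadd, quad_scale] at h1
    change _ ≤ _ + _ * quad 1 _ at h1
    rwa [quad_one] at h1

/-- Inversion turns a congruence `A ↦ T A s` into the congruence `A ↦ S A R`, where `S` is inverse
to `s` and `R` is inverse to `T`. -/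
theorem apply_eq_of_coneInv {A B C : PosCone H} (hA : IsStrictlyPositive A.1)
    (hB : IsStrictlyPositive B.1) {T s S R : H → H} (hC : ∀ z, C.1 z = T (A.1 (s z)))
    (hinv : C = coneInv B) (hs : ∀ z, s (S z) = z) (hT : ∀ z, T (R z) = z) (z : H) :
    B.1 z = S ((coneInv A).1 (R z)) := by
  have h1 : C.1 (S ((coneInv A).1 (R z))) = z := by
    rw [hC, hs]
    have : A.1 ((coneInv A).1 (R z)) = R z := by
      rw [← mul_apply_eq_comp]
      change (A.1 * Ring.inverse A.1) (R z) = R z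
      rw [Ring.mul_inverse_cancel _ hA.isUnit]; rfl
    rw [this, hT]
  have h2 : ∀ y, B.1 (C.1 y) = y := fun y => by
    rw [hinv, ← mul_apply_eq_comp]
    change (B.1 * Ring.inverse B.1) y = y
    rw [Ring.mul_inverse_cancel _ hB.isUnit]; rfl
  rw [← h2 (S _), h1]

/-- Every bijection of `B(H)⁺` preserving the harmonic mean is a congruence: inversion turns it
into an additive map on invertible operators. -/
theorem isCongruence_of_harmonicMean {ψ : PosCone H ≃ PosCone H} (h : PreservesHarmonicMean ψ) :
    IsCongruence ψ := by
  have hiso := h.isConeIso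
  have hsp : ∀ {A : PosCone H}, IsStrictlyPositive A.1 → IsStrictlyPositive (ψ A).1 :=
    fun hA => hiso.strictlyPositive hA
  have hsp' : ∀ {A : PosCone H}, IsStrictlyPositive A.1 → IsStrictlyPositive (ψ.symm A).1 :=
    fun hA => h.symm.isConeIso.strictlyPositive hA
  set θ : PosCone H → PosCone H := fun A => coneInv (ψ (coneInv A)) with hθ
  have θsp : ∀ {A : PosCone H}, IsStrictlyPositive A.1 → IsStrictlyPositive (θ A).1 := fun hA =>
    coneInv_strictlyPositive (hsp (coneInv_strictlyPositive hA))
  have θadd : ∀ {A B : PosCone H}, IsStrictlyPositive A.1 → IsStrictlyPositive B.1 →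
      θ (A + B) = θ A + θ B := fun {A B} hA hB => by
    have hAB : IsStrictlyPositive (A + B).1 := add_strictlyPositive hB
    have hAB' : IsStrictlyPositive (θ A + θ B).1 := add_strictlyPositive (θsp hB)
    have h1 := h (coneInv A) (coneInv B)
    have e : ∀ {A : PosCone H}, IsStrictlyPositive A.1 → ψ (coneInv A) = coneInv (θ A) :=
      fun hA => (coneInv_coneInv (hsp (coneInv_strictlyPositive hA))).symm
    rw [harmonicMean_coneInv hA hB, hiso.map_scale, e hA, e hB,
      harmonicMean_coneInv (θsp hA) (θsp hB)] at h1
    have h2 := congrArg (scale 2⁻¹) h1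
    rw [scale_scale, scale_scale, inv_mul_cancel₀ two_ne_zero, scale_one, scale_one] at h2
    rw [← coneInv_coneInv hAB', ← h2]
  have θle : ∀ {A B : PosCone H}, IsStrictlyPositive A.1 → IsStrictlyPositive B.1 →
      (θ A ≤ θ B ↔ A ≤ B) := fun {A B} hA hB => by
    have hA' := coneInv_strictlyPositive hA
    have hB' := coneInv_strictlyPositive hB
    constructor
    · intro hle
      have h1 := coneInv_le (θsp hA) (θsp hB) hle
      rw [hθ, coneInv_coneInv (hsp hA'), coneInv_coneInv (hsp hB'), hiso.le_iff] at h1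
      have h2 := coneInv_le hB' hA' h1
      rwa [coneInv_coneInv hA, coneInv_coneInv hB] at h2
    · intro hle
      exact coneInv_le (hsp hB') (hsp hA') ((hiso.le_iff _ _).mpr (coneInv_le hA hB hle))
  have θsurj : ∀ {C : PosCone H}, IsStrictlyPositive C.1 →
      ∃ A : PosCone H, IsStrictlyPositive A.1 ∧ θ A = C := fun {C} hC =>
    ⟨coneInv (ψ.symm (coneInv C)),
      coneInv_strictlyPositive (hsp' (coneInv_strictlyPositive hC)), by
        simp only [hθ]
        rw [coneInv_coneInv (hsp' (coneInv_strictlyPositive hC)), ψ.apply_symm_apply,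
          coneInv_coneInv hC]⟩
  have h1sp : IsStrictlyPositive (1 : PosCone H).1 := one_strictlyPositive
  have hA1 : ∀ A : PosCone H, IsStrictlyPositive (A + 1).1 := fun A => add_strictlyPositive h1sp
  have hle1 : ∀ A : PosCone H, (1 : PosCone H) ≤ A + 1 := fun A =>
    Subtype.coe_le_coe.mp (le_add_of_nonneg_left A.2)
  -- The additive extension of `θ` to noninvertible operators.
  have hex : ∀ A : PosCone H, ∃ B : PosCone H, B + θ 1 = θ (A + 1) := fun A =>
    ⟨⟨(θ (A + 1)).1 - (θ 1).1, sub_nonneg.mpr ((θle h1sp (hA1 A)).mpr (hle1 A))⟩,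
      Subtype.ext (sub_add_cancel _ _)⟩
  choose Θ hΘ using hex
  have cancel : ∀ {A B C : PosCone H}, A + C = B + C → A = B := fun {A B C} hABC =>
    Subtype.ext (add_right_cancel (congrArg Subtype.val hABC : A.1 + C.1 = B.1 + C.1))
  have Θeq : ∀ {A : PosCone H}, IsStrictlyPositive A.1 → Θ A = θ A := fun hA =>
    cancel (C := θ 1) (by rw [hΘ, θadd hA h1sp])
  have Θadd : ∀ A B, Θ (A + B) = Θ A + Θ B := fun A B => by
    refine cancel (C := θ 1 + θ 1) ?_
    calc Θ (A + B) + (θ 1 + θ 1) = θ ((A + B + 1) + 1) := by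
          rw [← add_assoc, hΘ, θadd (hA1 _) h1sp]
      _ = θ ((A + 1) + (B + 1)) := by congr 1; abel
      _ = (Θ A + θ 1) + (Θ B + θ 1) := by rw [θadd (hA1 _) (hA1 _), hΘ, hΘ]
      _ = _ := by abel
  have Θbij : Function.Bijective Θ := by
    constructor
    · intro A B hAB
      have h1 : θ (A + 1) = θ (B + 1) := by rw [← hΘ, ← hΘ, hAB]
      exact cancel (C := 1) (le_antisymm ((θle (hA1 A) (hA1 B)).mp h1.le)
        ((θle (hA1 B) (hA1 A)).mp h1.ge))
    · intro C
      obtain ⟨D, hD, hθD⟩ := θsurj (add_strictlyPositive (A := C) (θsp h1sp))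
      have h1 : (1 : PosCone H) ≤ D := (θle h1sp hD).mp (by
        rw [hθD]; exact Subtype.coe_le_coe.mp (le_add_of_nonneg_left C.2))
      refine ⟨⟨D.1 - 1, sub_nonneg.mpr h1⟩, cancel (C := θ 1) ?_⟩
      rw [hΘ, ← hθD]
      congr 1
      exact Subtype.ext (sub_add_cancel _ _)
  have hψθ : ∀ {A : PosCone H}, IsStrictlyPositive A.1 → Θ (coneInv A) = coneInv (ψ A) :=
    fun hA => by
      rw [Θeq (coneInv_strictlyPositive hA)]
      simp only [hθ, coneInv_coneInv hA]
  have hstrict : ∀ A : PosCone H, IsStrictlyPositive (ψ A).1 → IsStrictlyPositive A.1 :=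
    fun A hA => by simpa using hsp' hA
  rcases isCongruence_of_additive Θbij Θadd with ⟨T, hT⟩ | ⟨T, hT⟩
  · left
    set S : H ≃L[ℂ] H := ContinuousLinearEquiv.equivOfInverse (adjoint (T.symm : H →L[ℂ] H))
      (adjoint (T : H →L[ℂ] H)) (adjoint_adjoint_symm T) (adjoint_adjoint_symm T.symm) with hS
    refine ⟨S, hiso.eq_of_strictlyPositive (quad_linearCongruence _) (fun A hA => ?_) hstrict⟩
    refine Subtype.ext (ContinuousLinearMap.ext fun z => ?_)
    rw [apply_eq_of_coneInv (coneInv_strictlyPositive hA) (hsp hA) (T := T)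
      (s := adjoint (T : H →L[ℂ] H)) (S := S) (R := T.symm) (fun z => by rw [hT]; rfl) (hψθ hA)
      (adjoint_adjoint_symm T) T.apply_symm_apply z, coneInv_coneInv hA]
    have hSs : (adjoint (S : H →L[ℂ] H)) = T.symm :=
      ContinuousLinearMap.adjoint_adjoint (T.symm : H →L[ℂ] H)
    change _ = S (A.1 (adjoint (S : H →L[ℂ] H) z))
    rw [hSs]
    rfl
  · right
    set S : H ≃SL[starRingEnd ℂ] H := ContinuousLinearEquiv.equivOfInverse
      (conjAdjoint (T.symm : H →L⋆[ℂ] H)) (conjAdjoint (T : H →L⋆[ℂ] H))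
      (conjAdjoint_conjAdjoint_symm T) (conjAdjoint_conjAdjoint_symm T.symm) with hS
    refine ⟨S, hiso.eq_of_strictlyPositive (quad_conjCongruence _) (fun A hA => ?_) hstrict⟩
    refine Subtype.ext (ContinuousLinearMap.ext fun z => ?_)
    rw [apply_eq_of_coneInv (coneInv_strictlyPositive hA) (hsp hA) (T := T)
      (s := conjAdjoint (T : H →L⋆[ℂ] H)) (S := S) (R := T.symm) (fun z => by rw [hT]; rfl) (hψθ hA)
      (conjAdjoint_conjAdjoint_symm T) T.apply_symm_apply z, coneInv_coneInv hA]
    have hSs : conjAdjoint (S : H →L⋆[ℂ] H) = T.symm :=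
      conjAdjoint_conjAdjoint (T.symm : H →L⋆[ℂ] H)
    change _ = S (A.1 (conjAdjoint (S : H →L⋆[ℂ] H) z))
    rw [hSs]
    rfl

/-! ### Power means -/

theorem power_power_inv (A : PosCone H) {r : ℝ} (hr : 0 < r) : power (power A r) (1 / r) = A :=
  Subtype.ext (by
    change (A.1 ^ r) ^ (1 / r) = A.1
    rw [CFC.rpow_rpow_of_exponent_nonneg A.1 r (1 / r) hr.le (by positivity) A.2,
      mul_one_div_cancel hr.ne', CFC.rpow_one A.1 A.2])

theorem power_inv_power (A : PosCone H) {r : ℝ} (hr : 0 < r) : power (power A (1 / r)) r = A := by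
  simpa using power_power_inv A (one_div_pos.mpr hr)

/-- The bijection `A ↦ A ^ r` of the cone, for `r > 0`. -/
noncomputable def powerEquiv {r : ℝ} (hr : 0 < r) : PosCone H ≃ PosCone H where
  toFun A := power A r
  invFun A := power A (1 / r)
  left_inv A := power_power_inv A hr
  right_inv A := power_inv_power A hr

/-- The mean of which the `p`th power mean is the transform by `A ↦ A ^ |p|`: the arithmetic mean
if `p > 0` and the harmonic mean otherwise. -/
noncomputable def baseMean (p : ℝ) (A B : PosCone H) : PosCone H :=
  if 0 < p then arithmeticMean A B else harmonicMean A B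

theorem powerMean_eq (p : ℝ) (A B : PosCone H) :
    powerMean p A B = power (baseMean p (power A |p|) (power B |p|)) (1 / |p|) := by
  unfold powerMean baseMean
  split_ifs with h
  · rw [abs_of_pos h]
  · rfl

theorem IsCongruence.map_baseMean {ψ : PosCone H → PosCone H} (h : IsCongruence ψ) (p : ℝ)
    (A B : PosCone H) : ψ (baseMean p A B) = baseMean p (ψ A) (ψ B) := by
  obtain ⟨s, hsub, hsurj, hq⟩ := h.exists_quad_eq
  unfold baseMean
  split_ifs
  · exact PosCone.ext_quad fun z => by
      rw [hq, quad_arithmeticMean, quad_arithmeticMean, hq, hq]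
  · exact (harmonicMean_congruence hq hsub hsurj A B).symm

theorem isCongruence_of_baseMean {ψ : PosCone H → PosCone H} (hψ : Function.Bijective ψ) {p : ℝ}
    (h : ∀ A B, ψ (baseMean p A B) = baseMean p (ψ A) (ψ B)) : IsCongruence ψ := by
  unfold baseMean at h
  split_ifs at h
  · exact isCongruence_of_arithmeticMean hψ h
  · exact isCongruence_of_harmonicMean (ψ := Equiv.ofBijective ψ hψ) h

/-- The asserted forms of `φ` say that `A ↦ φ (A ^ (1 / r)) ^ r` is a congruence. -/
theorem hasForm_iff {r : ℝ} (hr : 0 < r) (φ : PosCone H → PosCone H) :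
    ((∃ T : H ≃L[ℂ] H, HasLinearForm r φ (T : H →L[ℂ] H)) ∨
      (∃ T : H ≃SL[starRingEnd ℂ] H, HasConjLinearForm r φ (T : H →L⋆[ℂ] H))) ↔
    IsCongruence fun A => power (φ (power A (1 / r))) r := by
  have key : ∀ K : PosCone H → PosCone H, (∀ A, (φ A).1 = (K (power A r)).1 ^ (1 / r)) ↔
      (fun A => power (φ (power A (1 / r))) r) = K := fun K => by
    constructor
    · intro h
      funext A
      have h1 : φ (power A (1 / r)) = power (K A) (1 / r) := Subtype.ext (by
        rw [h, power_inv_power A hr]; rfl)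
      rw [h1, power_inv_power _ hr]
    · rintro rfl A
      have h1 := power_power_inv (φ A) hr
      rw [← power_power_inv A hr] at h1
      have h2 := congrArg Subtype.val h1
      rw [power_power_inv A hr] at h2
      simp only [power_power_inv A hr]
      exact h2.symm
  exact or_congr (exists_congr fun T => key (linearCongruence (T : H →L[ℂ] H)))
    (exists_congr fun T => key (conjCongruence (T : H →L⋆[ℂ] H)))

/-- A map preserves the power mean exactly when its conjugate by `A ↦ A ^ |p|` preserves the
arithmetic or the harmonic mean. -/
theorem preserves_powerMean_iff {p : ℝ} (hp : p ≠ 0) (φ : PosCone H → PosCone H) :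
    (∀ A B, φ (powerMean p A B) = powerMean p (φ A) (φ B)) ↔
      ∀ A B, power (φ (power (baseMean p A B) (1 / |p|))) |p| =
        baseMean p (power (φ (power A (1 / |p|))) |p|) (power (φ (power B (1 / |p|))) |p|) := by
  have hr : 0 < |p| := abs_pos.mpr hp
  simp only [powerMean_eq]
  constructor
  · intro h A B
    have h1 := h (power A (1 / |p|)) (power B (1 / |p|))
    rw [power_inv_power A hr, power_inv_power B hr] at h1
    rw [h1, power_inv_power _ hr]
  · intro h A B
    have h1 := h (power A |p|) (power B |p|)
    rw [power_power_inv A hr, power_power_inv B hr] at h1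
    rw [← h1, power_power_inv _ hr]

end PowerMeans

theorem theorem4 {H : Type*} [NormedAddCommGroup H] [InnerProductSpace ℂ H] [CompleteSpace H]
    (p : ℝ) (hp : p ∈ Set.Icc (-1 : ℝ) 1) (hp0 : p ≠ 0) :
    (∀ φ : PowerMeans.PosCone H → PowerMeans.PosCone H, Function.Bijective φ →
      (∀ A B, φ (PowerMeans.powerMean p A B) = PowerMeans.powerMean p (φ A) (φ B)) →
      (∃ T : H ≃L[ℂ] H, PowerMeans.HasLinearForm |p| φ (T : H →L[ℂ] H)) ∨
      (∃ T : H ≃SL[starRingEnd ℂ] H, PowerMeans.HasConjLinearForm |p| φ (T : H →L⋆[ℂ] H))) ∧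
    (∀ φ : PowerMeans.PosCone H → PowerMeans.PosCone H,
      ((∃ T : H ≃L[ℂ] H, PowerMeans.HasLinearForm |p| φ (T : H →L[ℂ] H)) ∨
      (∃ T : H ≃SL[starRingEnd ℂ] H, PowerMeans.HasConjLinearForm |p| φ (T : H →L⋆[ℂ] H))) →
      ∀ A B, φ (PowerMeans.powerMean p A B) = PowerMeans.powerMean p (φ A) (φ B)) := by
  have hr : 0 < |p| := abs_pos.mpr hp0
  refine ⟨fun φ hφ h => ?_, fun φ hform => ?_⟩
  · rw [PowerMeans.hasForm_iff hr]
    have hbij : Function.Bijective fun A : PowerMeans.PosCone H =>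
        PowerMeans.power (φ (PowerMeans.power A (1 / |p|))) |p| :=
      (PowerMeans.powerEquiv hr).bijective.comp
        (hφ.comp (PowerMeans.powerEquiv hr).symm.bijective)
    exact PowerMeans.isCongruence_of_baseMean hbij
      ((PowerMeans.preserves_powerMean_iff hp0 φ).mp h)
  · exact (PowerMeans.preserves_powerMean_iff hp0 φ).mpr
      (((PowerMeans.hasForm_iff hr φ).mp hform).map_baseMean p)
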